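/- Let $G$ be a linear Lie group with finitely many connected components, that is, a closed subgroup of $\mathrm{GL}(m,\mathbb{C})$ whose identity component $G^0$ has finite index. Let $\Lambda < G$ be an arithmetic subgroup (for instance an arithmetic lattice in $G$): there are a linear algebraic $\mathbb{Q}$-group $\mathbf{H} < \mathrm{GL}_N$ and a surjective homomorphism $\varphi\colon \mathbf{H}(\mathbb{R})^0 \to G^0$ with compact kernel, whose matrix coefficients are polynomials in the entries of $h$ and $h^{-1}$, such that $\Lambda$ is commensurable with $\varphi(\mathbf{H}(\mathbb{R})^0 \cap \mathrm{GL}(N,\mathbb{Z}))$. Let $\Gamma < \Lambda$ be a subgroup that is torsion free and virtually unipotent, i.e. $\Gamma$ has a finite index subgroup that is conjugate in $\mathrm{GL}(m,\mathbb{C})$ into the group of upper triangular matrices with ones along the diagonal. Then there exists a torsion free, finite index subgroup $\Lambda_0$ of $\Lambda$ such that $\Gamma < \Lambda_0$. -/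

import Mathlib

namespace ArithLattice

open Matrix

/-- A group is torsion free if its only element of finite order is the identity. -/
def TorsionFree {A : Type*} [Group A] (Γ : Subgroup A) : Prop :=
  ∀ g ∈ Γ, IsOfFinOrder g → g = 1

/-- A subgroup of `GL(m, ℂ)` is unipotent if it is conjugate in `GL(m, ℂ)` into the group of
upper triangular matrices with ones along the diagonal. -/
def IsUnipotent {m : ℕ} (U : Subgroup (GL (Fin m) ℂ)) : Prop :=
  ∃ P : GL (Fin m) ℂ, ∀ g ∈ U,
    (∀ i, (P * g * P⁻¹) i i = 1) ∧ ∀ i j, j < i → (P * g * P⁻¹) i j = 0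

/-- `Γ` has a unipotent subgroup of finite index. -/
def IsVirtuallyUnipotent {m : ℕ} (Γ : Subgroup (GL (Fin m) ℂ)) : Prop :=
  ∃ U : Subgroup (GL (Fin m) ℂ), U ≤ Γ ∧ U.IsFiniteRelIndex Γ ∧ IsUnipotent U

/-- The identity component of a subgroup `G` of a topological group (for the subspace topology),
as a subgroup of the ambient group. -/
def identityComponent {A : Type*} [Group A] [TopologicalSpace A] [IsTopologicalGroup A]
    (G : Subgroup A) : Subgroup A :=
  (Subgroup.connectedComponentOfOne G).map G.subtype

/-- A linear algebraic `ℚ`-group, given by its group of complex points: the subgroup `H` of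
`GL(N, ℂ)` is the set of common zeros in `GL(N, ℂ)` of polynomials with rational coefficients
in the matrix entries. -/
def IsAlgebraicOverRat {N : ℕ} (H : Subgroup (GL (Fin N) ℂ)) : Prop :=
  ∃ S : Set (MvPolynomial (Fin N × Fin N) ℚ), ∀ g : GL (Fin N) ℂ,
    g ∈ H ↔ ∀ p ∈ S, MvPolynomial.aeval (fun ij : Fin N × Fin N => g ij.1 ij.2) p = 0

/-- The group `H(ℝ)` of real points. -/
noncomputable def realPoints {N : ℕ} (H : Subgroup (GL (Fin N) ℂ)) : Subgroup (GL (Fin N) ℝ) :=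
  H.comap (GeneralLinearGroup.map (algebraMap ℝ ℂ))

/-- `GL(N, ℤ)` as a subgroup of `GL(N, ℝ)`. -/
def integralGL (N : ℕ) : Subgroup (GL (Fin N) ℝ) :=
  (GeneralLinearGroup.map (Int.castRingHom ℝ)).range

/-- The homomorphism `φ` into `GL(m, ℂ)` is regular: each matrix coefficient of `φ h` is a
polynomial, with complex coefficients, in the entries of `h` and of `h⁻¹`. -/
def IsRegularHom {N m : ℕ} {L : Subgroup (GL (Fin N) ℝ)} (φ : L →* GL (Fin m) ℂ) : Prop :=
  ∀ i j : Fin m, ∃ p : MvPolynomial ((Fin N × Fin N) ⊕ (Fin N × Fin N)) ℂ, ∀ h : L,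
    φ h i j = MvPolynomial.eval
      (Sum.elim (fun ab => (((h : GL (Fin N) ℝ) ab.1 ab.2 : ℝ) : ℂ))
        (fun ab => (((h : GL (Fin N) ℝ)⁻¹ ab.1 ab.2 : ℝ) : ℂ))) p

/-- `Λ` is an arithmetic subgroup of the linear Lie group `G`: there are a linear algebraic
`ℚ`-group `H` and a regular homomorphism `φ` with compact kernel from `H(ℝ)⁰` onto `G⁰`, such
that `Λ` is commensurable with the image under `φ` of the integral points of `H(ℝ)⁰`. -/
def IsArithmetic {m : ℕ} (G Λ : Subgroup (GL (Fin m) ℂ)) : Prop :=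
  Λ ≤ G ∧
  ∃ (N : ℕ) (H : Subgroup (GL (Fin N) ℂ)) (φ : identityComponent (realPoints H) →* GL (Fin m) ℂ),
    IsAlgebraicOverRat H ∧ IsRegularHom φ ∧
    IsCompact (φ.ker : Set (identityComponent (realPoints H))) ∧
    φ.range = identityComponent G ∧
    Subgroup.Commensurable
      (((integralGL N).subgroupOf (identityComponent (realPoints H))).map φ) Λ

end ArithLattice

/-! The group sought is `Γ M`, where `M` is a small finite index subgroup of `Λ` normalized by `Λ`.
Suppose `γ y` has finite order, with `γ ∈ Γ` and `y ∈ M`. For a suitable exponent `k` independent of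
`γ` and `y`, the power `γ ^ k` lies both in `M` and in the unipotent subgroup `U`. If `M` is deep
enough, `γ ^ k = w ^ k` for some `w ∈ U`. Unipotent roots are unique, so `γ` commutes with `w`; then
`γ w⁻¹` is a torsion element of `Γ`, whence `γ = w`. This puts `γ y` in the image of the congruence
subgroup of level 3, which is torsion free (`exists_torsionFree_of_hom`).

Two facts feed this argument. First, unipotency lifts through `φ`: if `φ h` is unipotent, the
hyperbolic one-parameter group `|h| ^ t` lies in `H(ℝ)⁰` and in `ker φ`. Compactness forces the
eigenvalues of `h` onto the unit circle (`norm_eq_one_of_isRoot_charpoly`), and an integral `h ≡ 1`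
mod 3 of this kind is unipotent (`isNilpotent_sub_one_of_roots_norm_eq_one`).

Second, roots exist inside a given unipotent group `Δ` of integral matrices
(`exists_level_of_powers`). The binomial series for `h ^ (1/D)` is integral once `h` is close to 1.
That the root belongs to `Δ` is a congruence subgroup property, proved by peeling off characters of
`Δ` (`exists_level_of_curves`). -/

namespace ArithLattice

open Matrix Polynomial

/-! ### Exponential polynomials and powers of complex matrices. -/

/-- The ring of formal exponential polynomials: `single μ P` stands for `n ↦ P(n) μ ^ n`. -/
abbrev ExpPoly : Type := MonoidAlgebra ℂ[X] ℂˣ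

namespace ExpPoly

/-- The value of an exponential polynomial at a natural number. -/
noncomputable def evalNat (n : ℕ) : ExpPoly →+* ℂ :=
  MonoidAlgebra.liftNCRingHom (Polynomial.evalRingHom (n : ℂ))
    ((powMonoidHom n).comp (Units.coeHom ℂ)) fun _ _ => Commute.all _ _

/-- The ring homomorphism sending `P(n) μ ^ n` to `P(0) |μ| ^ t`. -/
noncomputable def absEval (t : ℝ) : ExpPoly →+* ℂ :=
  MonoidAlgebra.liftNCRingHom (Polynomial.evalRingHom (0 : ℂ))
    { toFun := fun μ : ℂˣ => ((‖(μ : ℂ)‖ ^ t : ℝ) : ℂ)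
      map_one' := by simp
      map_mul' := fun a b => by
        simp [Real.mul_rpow (norm_nonneg _) (norm_nonneg _)] } fun _ _ => Commute.all _ _

/-- Complex conjugation of exponential polynomials. -/
noncomputable def conj : ExpPoly →+* ExpPoly :=
  MonoidAlgebra.liftNCRingHom
    (MonoidAlgebra.singleOneRingHom.comp (Polynomial.mapRingHom (starRingEnd ℂ)))
    ((MonoidAlgebra.of ℂ[X] ℂˣ).comp (Units.map (starRingEnd ℂ).toMonoidHom))
    fun _ _ => Commute.all _ _

lemma evalNat_single (n : ℕ) (μ : ℂˣ) (P : ℂ[X]) :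
    evalNat n (MonoidAlgebra.single μ P) = P.eval (n : ℂ) * (μ : ℂ) ^ n := by
  simp [evalNat]

lemma absEval_single (t : ℝ) (μ : ℂˣ) (P : ℂ[X]) :
    absEval t (MonoidAlgebra.single μ P) = P.eval 0 * ((‖(μ : ℂ)‖ ^ t : ℝ) : ℂ) := by
  simp [absEval]

lemma conj_single (μ : ℂˣ) (P : ℂ[X]) :
    conj (MonoidAlgebra.single μ P) =
      MonoidAlgebra.single (Units.map (starRingEnd ℂ).toMonoidHom μ) (P.map (starRingEnd ℂ)) := by
  simp [conj]

lemma evalNat_conj (n : ℕ) (F : ExpPoly) :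
    evalNat n (conj F) = starRingEnd ℂ (evalNat n F) := by
  induction F using MonoidAlgebra.induction_linear with
  | zero => simp
  | add x y hx hy => simp [hx, hy]
  | single μ P => simp [conj_single, evalNat_single]

lemma absEval_conj (t : ℝ) (F : ExpPoly) :
    absEval t (conj F) = starRingEnd ℂ (absEval t F) := by
  induction F using MonoidAlgebra.induction_linear with
  | zero => simp
  | add x y hx hy => simp [hx, hy]
  | single μ P => simp [conj_single, absEval_single]

lemma absEval_zero (F : ExpPoly) : absEval 0 F = evalNat 0 F := by
  induction F using MonoidAlgebra.induction_linear with
  | zero => simp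
  | add x y hx hy => simp [hx, hy]
  | single μ P => simp [evalNat_single, absEval_single]

lemma continuous_absEval (F : ExpPoly) : Continuous fun t => absEval t F := by
  induction F using MonoidAlgebra.induction_linear with
  | zero => simpa using continuous_const
  | add x y hx hy => simpa using! hx.add hy
  | single μ P =>
    simp only [absEval_single]
    refine continuous_const.mul (Complex.continuous_ofReal.comp ?_)
    exact Real.continuous_const_rpow (by simp)

/-- The shift operator on complex sequences. -/
def shift : Module.End ℂ (ℕ → ℂ) where
  toFun s n := s (n + 1)
  map_add' _ _ := rfl
  map_smul' _ _ := rfl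

/-- On `a n * μ ^ n` the operator `shift - μ` is the forward difference on `a`, times `μ`.
Polynomials are killed by iterated differences, which places `P(n) μ ^ n` in a generalized
eigenspace. -/
lemma shift_sub_pow_apply (μ : ℂ) (a : ℂ → ℂ) (d : ℕ) :
    ((shift - μ • (1 : Module.End ℂ (ℕ → ℂ))) ^ d) (fun n : ℕ => a n * μ ^ n) =
      fun n : ℕ => (fwdDiff 1)^[d] a n * μ ^ (n + d) := by
  induction d with
  | zero => simp
  | succ d ih =>
    rw [pow_succ', Module.End.mul_apply, ih]
    funext n
    simp only [shift, LinearMap.sub_apply, LinearMap.coe_mk, AddHom.coe_mk, LinearMap.smul_apply,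
      Module.End.one_apply, Pi.sub_apply, Pi.smul_apply, smul_eq_mul, Function.iterate_succ_apply',
      fwdDiff]
    push_cast
    ring

lemma mem_maxGenEigenspace_shift (μ : ℂ) (P : ℂ[X]) :
    (fun n : ℕ => P.eval (n : ℂ) * μ ^ n) ∈ Module.End.maxGenEigenspace shift μ := by
  rw [Module.End.mem_maxGenEigenspace]
  refine ⟨P.natDegree + 1, ?_⟩
  rw [shift_sub_pow_apply μ (fun x => P.eval x)]
  rw [Polynomial.fwdDiff_iter_eq_zero_of_degree_lt (Nat.lt_succ_self _)]
  funext n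
  simp

/-- Generalized eigenspaces of `shift` for distinct `μ` are independent, so each term `P(n) μ ^ n`
vanishes separately. Since `μ ≠ 0`, `P` then has infinitely many roots. -/
lemma eq_zero_of_evalNat (F : ExpPoly) (hF : ∀ n, evalNat n F = 0) : F = 0 := by
  classical
  have hsum : ∀ n, evalNat n F =
      ∑ μ ∈ F.coeff.support, (F.coeff μ).eval (n : ℂ) * (μ : ℂ) ^ n := fun n => by
    conv_lhs => rw [← MonoidAlgebra.sum_coeff_single F]
    simp [Finsupp.sum, evalNat_single]
  have hind := (iSupIndep_iff_finsetSum_eq_zero_imp_eq_zero _).1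
    ((Module.End.independent_maxGenEigenspace shift).comp
      (f := fun μ : ℂˣ => (μ : ℂ)) Units.val_injective)
    F.coeff.support (fun μ (n : ℕ) => (F.coeff μ).eval (n : ℂ) * (μ : ℂ) ^ n)
    (fun μ _ => mem_maxGenEigenspace_shift _ _)
    (by funext n; simpa [hsum] using hF n)
  have hz : F.coeff = 0 := by
    by_contra hne
    obtain ⟨μ, hμ⟩ := Finsupp.support_nonempty_iff.2 hne
    refine Finsupp.mem_support_iff.1 hμ (Polynomial.eq_zero_of_infinite_isRoot _ ?_)
    refine (Set.infinite_range_of_injective (Nat.cast_injective (R := ℂ))).mono ?_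
    rintro _ ⟨n, rfl⟩
    have := congrFun (hind μ hμ) n
    simpa using this
  rw [← MonoidAlgebra.sum_coeff_single F, hz]
  simp

lemma ext_evalNat {F G : ExpPoly} (h : ∀ n, evalNat n F = evalNat n G) : F = G :=
  sub_eq_zero.1 (eq_zero_of_evalNat _ fun n => by simp [h n])

end ExpPoly

open ExpPoly

variable {N : ℕ}

/-- The sequences represented by exponential polynomials, as a submodule. -/
noncomputable def expPolySeq : Submodule ℂ (ℕ → ℂ) where
  carrier := {s | ∃ F : ExpPoly, ∀ n, evalNat n F = s n}
  zero_mem' := ⟨0, by simp⟩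
  add_mem' := by
    rintro _ _ ⟨F, hF⟩ ⟨G, hG⟩
    exact ⟨F + G, fun n => by simp [hF, hG]⟩
  smul_mem' := by
    rintro c _ ⟨F, hF⟩
    exact ⟨MonoidAlgebra.single 1 (C c) * F, fun n => by simp [hF, evalNat_single]⟩

/-- The binomial coefficient polynomial. -/
noncomputable def binomPoly (K : Type*) [Field K] (j : ℕ) : K[X] :=
  C ((j.factorial : K)⁻¹) * descPochhammer K j

lemma binomPoly_eval_natCast {K : Type*} [Field K] [CharZero K] (j n : ℕ) :
    (binomPoly K j).eval (n : K) = n.choose j := by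
  rw [binomPoly, Nat.cast_choose_eq_descPochhammer_div K n j]
  simp [div_eq_inv_mul]

/-- Binomial expansion of `((f - μ) + μ) ^ n`. The range of summation does not depend on `n`, so the
right side is an exponential polynomial in `n`. -/
lemma pow_eq_sum_of_pow_sub_eq_zero {V : Type*} [AddCommGroup V] [Module ℂ V]
    (f : Module.End ℂ V) (μ : ℂ) (hμ : μ ≠ 0) (k : ℕ) (v : V)
    (hv : ((f - μ • (1 : Module.End ℂ V)) ^ k) v = 0) (n : ℕ) :
    (f ^ n) v = ∑ j ∈ Finset.range k, ((n.choose j : ℂ) * (μ ^ n * (μ ^ j)⁻¹)) •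
      ((f - μ • (1 : Module.End ℂ V)) ^ j) v := by
  set g := f - μ • (1 : Module.End ℂ V) with hg
  have hf : f = g + μ • 1 := by simp [hg]
  have hgk : ∀ j, k ≤ j → (g ^ j) v = 0 := fun j hj => by
    obtain ⟨i, rfl⟩ := Nat.exists_eq_add_of_le' hj
    rw [pow_add, Module.End.mul_apply, hv, map_zero]
  have hc : Commute g (μ • (1 : Module.End ℂ V)) := (Commute.one_right g).smul_right μ
  have key : (f ^ n) v = ∑ j ∈ Finset.range (n + 1),
      ((n.choose j : ℂ) * (μ ^ n * (μ ^ j)⁻¹)) • (g ^ j) v := by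
    rw [hf, hc.add_pow, LinearMap.sum_apply]
    refine Finset.sum_congr rfl fun j hj => ?_
    have hjn : j ≤ n := Nat.lt_succ_iff.1 (Finset.mem_range.1 hj)
    have : μ ^ n * (μ ^ j)⁻¹ = μ ^ (n - j) := by
      rw [← Nat.sub_add_cancel hjn, pow_add, Nat.add_sub_cancel]
      field_simp
    rw [this, _root_.smul_pow, one_pow, ← nsmul_eq_mul', LinearMap.smul_apply, Module.End.mul_apply,
      LinearMap.smul_apply, Module.End.one_apply, map_smul, ← Nat.cast_smul_eq_nsmul ℂ, smul_smul]
  rw [key]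
  rcases le_total (n + 1) k with h | h
  · refine Finset.sum_subset (Finset.range_mono h) fun j _ hj => ?_
    rw [Nat.choose_eq_zero_of_lt (by simpa using hj)]
    simp
  · symm
    refine Finset.sum_subset (Finset.range_mono h) fun j _ hj => ?_
    rw [hgk j (by simpa using hj), smul_zero]

/-- The matrix coefficients of the powers of an invertible complex matrix are exponential
polynomials. -/
lemma exists_expPoly_pow (A : GL (Fin N) ℂ) :
    ∃ F : Matrix (Fin N) (Fin N) ExpPoly, ∀ n, F.map (evalNat n) = ((A ^ n : GL (Fin N) ℂ) :
      Matrix (Fin N) (Fin N) ℂ) := by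
  set f : Module.End ℂ (Fin N → ℂ) := Matrix.toLin' (A : Matrix (Fin N) (Fin N) ℂ) with hf
  have hfinj : Function.Injective f := by
    rw [hf]
    exact Matrix.mulVec_injective_of_isUnit A.isUnit
  let W : Submodule ℂ (Fin N → ℂ) :=
    { carrier := {v | ∀ i, (fun n => (f ^ n) v i) ∈ expPolySeq}
      zero_mem' := fun i => by
        simp only [map_zero]
        exact expPolySeq.zero_mem
      add_mem' := fun {a b} ha hb i => by simpa using! expPolySeq.add_mem (ha i) (hb i)
      smul_mem' := fun c a ha i => by simpa using! expPolySeq.smul_mem c (ha i) }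
  have hW : W = ⊤ := by
    rw [eq_top_iff, ← Module.End.iSup_maxGenEigenspace_eq_top f, iSup_le_iff]
    intro μ v hv i
    obtain ⟨k, hk⟩ := (Module.End.mem_maxGenEigenspace _ _ _).1 hv
    rcases eq_or_ne μ 0 with rfl | hμ
    · have : v = 0 := by
        have hinj : Function.Injective (f ^ k) := by
          rw [Module.End.coe_pow]; exact hfinj.iterate k
        apply hinj
        simpa using hk
      rw [this]
      exact W.zero_mem i
    · have : (fun n => (f ^ n) v i) = ∑ j ∈ Finset.range k,
          ((μ ^ j)⁻¹ * ((f - μ • (1 : Module.End ℂ (Fin N → ℂ))) ^ j) v i) •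
            (fun n : ℕ => (binomPoly ℂ j).eval (n : ℂ) * μ ^ n) := by
        funext n
        rw [pow_eq_sum_of_pow_sub_eq_zero f μ hμ k v hk n]
        simp only [Finset.sum_apply, Pi.smul_apply, smul_eq_mul, binomPoly_eval_natCast]
        exact Finset.sum_congr rfl fun j _ => by ring
      rw [this]
      refine Submodule.sum_mem _ fun j _ => Submodule.smul_mem _ _ ?_
      exact ⟨MonoidAlgebra.single (Units.mk0 μ hμ) (binomPoly ℂ j), fun n => by
        simp [evalNat_single]⟩
  have hall : ∀ i j, ∃ F : ExpPoly, ∀ n, evalNat n F =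
      ((A ^ n : GL (Fin N) ℂ) : Matrix (Fin N) (Fin N) ℂ) i j := fun i j => by
    have : Pi.single j 1 ∈ W := hW ▸ Submodule.mem_top
    obtain ⟨F, hF⟩ := this i
    refine ⟨F, fun n => ?_⟩
    have hp : f ^ n = Matrix.toLin' ((A : Matrix (Fin N) (Fin N) ℂ) ^ n) := by
      rw [hf, Matrix.toLin'_pow]
    rw [hF n, Units.val_pow_eq_pow_val]
    simp only [hp, Matrix.toLin'_apply, Matrix.mulVec_single_one]
    rfl
  choose F hF using hall
  exact ⟨Matrix.of F, fun n => by ext i j; simp [hF]⟩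

end ArithLattice

/-! ### The hyperbolic one-parameter group of a real matrix. -/

namespace ArithLattice

open Matrix Polynomial ExpPoly

variable {N : ℕ}

/-- The entries of a real matrix and of its inverse, as complex numbers. -/
noncomputable def entries (h : GL (Fin N) ℝ) : (Fin N × Fin N) ⊕ (Fin N × Fin N) → ℂ :=
  Sum.elim (fun ab => ((h ab.1 ab.2 : ℝ) : ℂ)) (fun ab => ((h⁻¹ ab.1 ab.2 : ℝ) : ℂ))

/-- The complexification of a real invertible matrix. -/
noncomputable abbrev toComplex (N : ℕ) : GL (Fin N) ℝ →* GL (Fin N) ℂ :=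
  GeneralLinearGroup.map (algebraMap ℝ ℂ)

/-- Exponential polynomial matrices which represent the powers of a real matrix `A` and of its
inverse, specialised by `absEval t`: these are the powers `|A| ^ t` of the hyperbolic part. -/
theorem exists_hyperbolic_path (A : GL (Fin N) ℝ) :
    ∃ p : ℝ → GL (Fin N) ℝ, Continuous p ∧ p 0 = 1 ∧
      (∀ (f : MvPolynomial ((Fin N × Fin N) ⊕ (Fin N × Fin N)) ℂ) (q : ℂ[X]),
        (∀ n : ℕ, MvPolynomial.eval (entries (A ^ n)) f = q.eval (n : ℂ)) →
          ∀ t, MvPolynomial.eval (entries (p t)) f = q.eval 0) ∧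
      ∀ z : ℂ, (toComplex N A : Matrix (Fin N) (Fin N) ℂ).charpoly.IsRoot z →
        ∃ v : Fin N → ℂ, v ≠ 0 ∧ ∀ t,
          (toComplex N (p t) : Matrix (Fin N) (Fin N) ℂ) *ᵥ v = ((‖z‖ ^ t : ℝ) : ℂ) • v := by
  obtain ⟨F, hF⟩ := exists_expPoly_pow (toComplex N A)
  obtain ⟨G, hG⟩ := exists_expPoly_pow (toComplex N A)⁻¹
  have hF' : ∀ n i j, evalNat n (F i j) = (((A ^ n : GL (Fin N) ℝ) i j : ℝ) : ℂ) := fun n i j => by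
    have := congrFun (congrFun (hF n) i) j
    rw [← map_pow] at this
    exact this
  have hG' : ∀ n i j, evalNat n (G i j) = ((((A ^ n)⁻¹ : GL (Fin N) ℝ) i j : ℝ) : ℂ) :=
    fun n i j => by
    have := congrFun (congrFun (hG n) i) j
    rw [← map_inv, ← map_pow, inv_pow] at this
    exact this
  have hext : ∀ {X Y : Matrix (Fin N) (Fin N) ExpPoly},
      (∀ n, X.map (evalNat n) = Y.map (evalNat n)) → X = Y := fun {X Y} h => by
    ext1 i j
    exact ext_evalNat fun n => congrFun (congrFun (h n) i) j
  -- Identities over `ExpPoly` are checked on the powers of `A`, then carried to every real `t` by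
  -- the ring homomorphism `absEval t`.
  have hFG : F * G = 1 := hext fun n => by
    rw [Matrix.map_mul, hF, hG, Matrix.map_one _ (map_zero _) (map_one _), inv_pow]
    exact Units.mul_inv _
  have hGF : G * F = 1 := hext fun n => by
    rw [Matrix.map_mul, hF, hG, Matrix.map_one _ (map_zero _) (map_one _), inv_pow]
    exact Units.inv_mul _
  -- Real values at all `n` make an entry invariant under `conj`, so its specialisations by
  -- `absEval` are real too.
  have hre : ∀ {X : Matrix (Fin N) (Fin N) ExpPoly},
      (∀ n i j, ∃ r : ℝ, evalNat n (X i j) = r) → ∀ t,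
        ((X.map (absEval t)).map Complex.re).map (algebraMap ℝ ℂ) = X.map (absEval t) :=
    fun {X} h t => by
    ext i j
    have : conj (X i j) = X i j := ext_evalNat fun n => by
      obtain ⟨r, hr⟩ := h n i j
      rw [evalNat_conj, hr, Complex.conj_ofReal]
    have h2 := absEval_conj t (X i j)
    rw [this] at h2
    simpa using! Complex.conj_eq_iff_re.1 h2.symm
  have hFre := hre fun n i j => ⟨_, hF' n i j⟩
  have hGre := hre fun n i j => ⟨_, hG' n i j⟩
  have hinj : Function.Injective
      fun X : Matrix (Fin N) (Fin N) ℝ => X.map (algebraMap ℝ ℂ) :=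
    Matrix.map_injective (algebraMap ℝ ℂ).injective
  have hmul : ∀ {X Y : Matrix (Fin N) (Fin N) ExpPoly}, X * Y = 1 →
      (∀ t, ((X.map (absEval t)).map Complex.re).map (algebraMap ℝ ℂ) = X.map (absEval t)) →
      (∀ t, ((Y.map (absEval t)).map Complex.re).map (algebraMap ℝ ℂ) = Y.map (absEval t)) →
      ∀ t, (X.map (absEval t)).map Complex.re * (Y.map (absEval t)).map Complex.re = 1 :=
    fun {X Y} h hX hY t => hinj <| by
    simp only [Matrix.map_mul, hX, hY]
    rw [← Matrix.map_mul, h, Matrix.map_one _ (map_zero _) (map_one _),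
      Matrix.map_one _ (map_zero _) (map_one _)]
  let p : ℝ → GL (Fin N) ℝ := fun t =>
    ⟨(F.map (absEval t)).map Complex.re, (G.map (absEval t)).map Complex.re,
      hmul hFG hFre hGre t, hmul hGF hGre hFre t⟩
  have hp : ∀ t i j, ((p t i j : ℝ) : ℂ) = absEval t (F i j) := fun t i j =>
    congrFun (congrFun (hFre t) i) j
  have hp' : ∀ t i j, (((p t)⁻¹ i j : ℝ) : ℂ) = absEval t (G i j) := fun t i j =>
    congrFun (congrFun (hGre t) i) j
  refine ⟨p, ?_, ?_, ?_, ?_⟩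
  · rw [Units.continuous_iff]
    constructor
    · exact continuous_matrix fun i j => Complex.continuous_re.comp (continuous_absEval (F i j))
    · exact continuous_matrix fun i j => Complex.continuous_re.comp (continuous_absEval (G i j))
  · ext i j
    have h1 := hp 0 i j
    rw [absEval_zero, hF', pow_zero] at h1
    exact_mod_cast h1
  · intro f q hq t
    let x : (Fin N × Fin N) ⊕ (Fin N × Fin N) → ExpPoly :=
      Sum.elim (fun ab => F ab.1 ab.2) (fun ab => G ab.1 ab.2)
    let c : ℂ →+* ExpPoly := MonoidAlgebra.singleOneRingHom.comp Polynomial.C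
    have hev : ∀ n, evalNat n (MvPolynomial.eval₂ c x f) =
        MvPolynomial.eval (entries (A ^ n)) f := fun n => by
      rw [MvPolynomial.hom_eval₂, MvPolynomial.eval, MvPolynomial.coe_eval₂Hom]
      congr 1
      · ext a; simp [c, evalNat_single]
      · funext ab
        rcases ab with ab | ab
        · exact hF' n ab.1 ab.2
        · exact hG' n ab.1 ab.2
    have habs : absEval t (MvPolynomial.eval₂ c x f) = MvPolynomial.eval (entries (p t)) f := by
      rw [MvPolynomial.hom_eval₂, MvPolynomial.eval, MvPolynomial.coe_eval₂Hom]
      congr 1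
      · ext a; simp [c, absEval_single]
      · funext ab
        rcases ab with ab | ab
        · exact (hp t ab.1 ab.2).symm
        · exact (hp' t ab.1 ab.2).symm
    have : MvPolynomial.eval₂ c x f = MonoidAlgebra.single 1 q := ext_evalNat fun n => by
      rw [hev, hq, evalNat_single]; simp
    rw [← habs, this, absEval_single]
    simp
  · intro z hz
    obtain ⟨v, hv0, hv⟩ := Matrix.exists_mulVec_eq_zero_iff.2
      (show (Matrix.scalar (Fin N) z - (toComplex N A : Matrix (Fin N) (Fin N) ℂ)).det = 0 by
        rw [← Matrix.eval_charpoly]; exact hz)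
    have hAv : (toComplex N A : Matrix (Fin N) (Fin N) ℂ) *ᵥ v = z • v := by
      rw [Matrix.sub_mulVec, sub_eq_zero] at hv
      rw [← hv]
      simp [Matrix.scalar_apply, ← Matrix.smul_one_eq_diagonal, Matrix.smul_mulVec]
    have hz0 : z ≠ 0 := by
      rintro rfl
      apply hv0
      apply Matrix.mulVec_injective_of_isUnit (toComplex N A).isUnit
      simpa using hAv
    have hpow : ∀ n : ℕ, (((toComplex N A) ^ n : GL (Fin N) ℂ) : Matrix (Fin N) (Fin N) ℂ) *ᵥ v =
        z ^ n • v := fun n => by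
      induction n with
      | zero => simp
      | succ n ih =>
        rw [pow_succ, Units.val_mul, ← Matrix.mulVec_mulVec, hAv, Matrix.mulVec_smul, ih, smul_smul,
          pow_succ']
    refine ⟨v, hv0, fun t => ?_⟩
    funext i
    -- The relation `A ^ n v = z ^ n v` as an identity of exponential polynomials; `absEval t`
    -- replaces `z ^ n` by `|z| ^ t` and leaves the constants `v i` alone.
    have key : ∑ j, F i j * MonoidAlgebra.single 1 (C (v j)) =
        MonoidAlgebra.single (Units.mk0 z hz0) (C (v i)) := ext_evalNat fun n => by
      have h1 := congrFun (hpow n) i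
      rw [← hF n] at h1
      simpa [Matrix.mulVec, dotProduct, evalNat_single, mul_comm] using h1
    have := congrArg (absEval t) key
    simp only [map_sum, map_mul, absEval_single, ← hp] at this
    simpa [Matrix.mulVec, dotProduct, mul_comm] using this

end ArithLattice

namespace ArithLattice

open Matrix Polynomial

/-! ### Integral matrices with small eigenvalues -/

lemma norm_multiset_prod_lt_one (s : Multiset ℂ) (hs : s ≠ 0) (h : ∀ z ∈ s, ‖z‖ < 1) :
    ‖s.prod‖ < 1 := by
  induction s using Multiset.induction_on with
  | empty => exact absurd rfl hs
  | cons a s ih =>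
    rw [Multiset.prod_cons, norm_mul]
    have ha : ‖a‖ < 1 := h a (Multiset.mem_cons_self a s)
    rcases eq_or_ne s 0 with rfl | hs'
    · simpa using ha
    · have := ih hs' fun z hz => h z (Multiset.mem_cons_of_mem hz)
      exact mul_lt_one_of_nonneg_of_lt_one_left (norm_nonneg _) ha this.le

/-- The constant coefficient is, up to sign, the product of the roots: an integer of absolute value
less than one, hence zero. Divide by `X` and induct. -/
lemma eq_X_pow_of_roots_norm_lt_one (p : ℤ[X]) (hp : p.Monic)
    (h : ∀ z : ℂ, (p.map (Int.castRingHom ℂ)).IsRoot z → ‖z‖ < 1) : p = X ^ p.natDegree := by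
  induction hn : p.natDegree generalizing p with
  | zero => rw [hp.natDegree_eq_zero.1 hn, pow_zero]
  | succ n ih =>
    have hpC : (p.map (Int.castRingHom ℂ)).Monic := hp.map _
    have hdeg : (p.map (Int.castRingHom ℂ)).natDegree = n + 1 := by
      rw [hp.natDegree_map, hn]
    have hroots : (p.map (Int.castRingHom ℂ)).roots ≠ 0 := by
      intro h0
      have := (IsAlgClosed.splits (p.map (Int.castRingHom ℂ))).natDegree_eq_card_roots
      rw [h0, hdeg] at this
      simp at this
    have hc := (IsAlgClosed.splits (p.map (Int.castRingHom ℂ))).coeff_zero_eq_prod_roots_of_monic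
      hpC
    have hlt : ‖(p.map (Int.castRingHom ℂ)).coeff 0‖ < 1 := by
      rw [hc, norm_mul, norm_pow, norm_neg, norm_one, one_pow, one_mul]
      exact norm_multiset_prod_lt_one _ hroots fun z hz => h z (isRoot_of_mem_roots hz)
    have h0 : p.coeff 0 = 0 := by
      rw [coeff_map, eq_intCast, Complex.norm_intCast] at hlt
      exact Int.abs_lt_one_iff.1 (by exact_mod_cast hlt)
    obtain ⟨q, rfl⟩ := X_dvd_iff.2 h0
    have hq : q.Monic := (monic_X.of_mul_monic_left hp)
    have hqn : q.natDegree = n := by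
      rw [monic_X.natDegree_mul hq, natDegree_X] at hn
      omega
    rw [ih q hq (fun z hz => h z ?_) hqn, pow_succ']
    simp only [IsRoot.def] at hz ⊢
    simp [hz]

lemma isNilpotent_of_roots_norm_lt_one {N : ℕ} (M : Matrix (Fin N) (Fin N) ℤ)
    (h : ∀ z : ℂ, (M.map (Int.castRingHom ℂ)).charpoly.IsRoot z → ‖z‖ < 1) : IsNilpotent M := by
  have := eq_X_pow_of_roots_norm_lt_one M.charpoly M.charpoly_monic fun z hz => h z (by
    rwa [Matrix.charpoly_map])
  refine ⟨M.charpoly.natDegree, ?_⟩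
  have hCH := Matrix.aeval_self_charpoly M
  rw [this] at hCH
  simpa using hCH

/-- An integral matrix which is congruent to the identity modulo `3` and whose complex eigenvalues
have absolute value one is unipotent. -/
lemma isNilpotent_sub_one_of_roots_norm_eq_one {N : ℕ} (h M : Matrix (Fin N) (Fin N) ℤ)
    (hM : h = 1 + (3 : ℤ) • M)
    (hr : ∀ z : ℂ, (h.map (Int.castRingHom ℂ)).charpoly.IsRoot z → ‖z‖ = 1) :
    IsNilpotent (h - 1) := by
  have : IsNilpotent M := isNilpotent_of_roots_norm_lt_one M fun z hz => by
    have hroot : (h.map (Int.castRingHom ℂ)).charpoly.IsRoot (1 + 3 * z) := by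
      rw [IsRoot.def, Matrix.eval_charpoly] at hz ⊢
      have : Matrix.scalar (Fin N) (1 + 3 * z) - h.map (Int.castRingHom ℂ) =
          (3 : ℂ) • (Matrix.scalar (Fin N) z - M.map (Int.castRingHom ℂ)) := by
        ext i j
        have he : h i j = (1 : Matrix (Fin N) (Fin N) ℤ) i j + 3 * M i j := by
          rw [hM, Matrix.add_apply, Matrix.smul_apply, smul_eq_mul]
        rcases eq_or_ne i j with rfl | hij
        · simp [he, Matrix.scalar_apply]; ring
        · simp [he, Matrix.scalar_apply, hij]
      rw [this, Matrix.det_smul, hz, mul_zero]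
    have h1 := hr _ hroot
    -- The level must exceed 2: the difference of two numbers on the unit circle has norm at most 2,
    -- which gives `‖z‖ ≤ 2/3 < 1`.
    have h2 : ‖(3 : ℂ) * z‖ ≤ 2 := by
      calc ‖(3 : ℂ) * z‖ = ‖(1 + 3 * z) - 1‖ := by congr 1; ring
        _ ≤ ‖1 + 3 * z‖ + ‖(1 : ℂ)‖ := norm_sub_le _ _
        _ = 2 := by rw [h1, norm_one]; norm_num
    rw [norm_mul] at h2
    norm_num at h2
    linarith
  rw [hM, add_sub_cancel_left]
  exact this.smul 3

/-! ### Powers of unipotent matrices -/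

variable {N : ℕ} {K : Type*} [Field K]

/-- The curve `t ↦ M ^ t` through the powers of a unipotent matrix `M` with `(M - 1) ^ d = 0`. -/
noncomputable def powCurve (M : Matrix (Fin N) (Fin N) K) (d : ℕ) :
    Matrix (Fin N) (Fin N) K[X] :=
  ∑ k ∈ Finset.range d, binomPoly K k • ((M - 1) ^ k).map C

lemma powCurve_map_eval (M : Matrix (Fin N) (Fin N) K) (d : ℕ) (t : K) :
    (powCurve M d).map (Polynomial.eval t) =
      ∑ k ∈ Finset.range d, (binomPoly K k).eval t • (M - 1) ^ k := by
  ext i j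
  simp [powCurve, Matrix.sum_apply, eval_finsetSum]

lemma powCurve_eval_natCast [CharZero K] (M : Matrix (Fin N) (Fin N) K) {d : ℕ}
    (hd : (M - 1) ^ d = 0) (n : ℕ) : (powCurve M d).map (Polynomial.eval (n : K)) = M ^ n := by
  have hM : M = (M - 1) + 1 := by simp
  rw [powCurve_map_eval]
  conv_rhs => rw [hM, (Commute.one_right (M - 1)).add_pow]
  simp only [binomPoly_eval_natCast, one_pow, mul_one]
  have hk : ∀ k, d ≤ k → (M - 1) ^ k = 0 := fun k hk => pow_eq_zero_of_le hk hd
  have e : ∀ k, (M - 1) ^ k * ((n.choose k : ℕ) : Matrix (Fin N) (Fin N) K) =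
      ((n.choose k : ℕ) : K) • (M - 1) ^ k := fun k => by
    rw [← nsmul_eq_mul', Nat.cast_smul_eq_nsmul]
  simp only [e]
  rcases le_total (n + 1) d with h | h
  · symm
    refine Finset.sum_subset (Finset.range_mono h) fun j _ hj => ?_
    rw [Nat.choose_eq_zero_of_lt (by simpa using hj)]
    simp
  · refine Finset.sum_subset (Finset.range_mono h) fun j _ hj => ?_
    rw [hk j (by simpa using hj), smul_zero]

lemma matrix_polynomial_ext [CharZero K] {x y : Matrix (Fin N) (Fin N) K[X]}
    {s : Set K} (hs : s.Infinite)
    (h : ∀ t ∈ s, x.map (Polynomial.eval t) = y.map (Polynomial.eval t)) : x = y := by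
  ext1 i j
  exact Polynomial.eq_of_infinite_eval_eq _ _
    (hs.mono fun t ht => congrFun (congrFun (h t ht) i) j)

/-- Roots of unipotent matrices are unique. -/
lemma eq_of_pow_eq_pow_of_isNilpotent_sub_one [CharZero K] {a b : Matrix (Fin N) (Fin N) K}
    (ha : IsNilpotent (a - 1)) (hb : IsNilpotent (b - 1)) {D : ℕ} (hD : D ≠ 0)
    (hab : a ^ D = b ^ D) : a = b := by
  obtain ⟨d, hd⟩ := ha
  obtain ⟨e, he⟩ := hb
  -- The two curves agree at all multiples of `D`, hence identically; they are compared at `1`.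
  have : powCurve a d = powCurve b e := by
    refine matrix_polynomial_ext (s := Set.range fun n : ℕ => ((D * n : ℕ) : K))
      (Set.infinite_range_of_injective fun m n h => ?_) ?_
    · exact Nat.eq_of_mul_eq_mul_left (Nat.pos_of_ne_zero hD) (Nat.cast_injective h)
    · rintro _ ⟨n, rfl⟩
      rw [powCurve_eval_natCast a hd, powCurve_eval_natCast b he, pow_mul, pow_mul, hab]
  have h1 := powCurve_eval_natCast a hd 1
  rw [this, powCurve_eval_natCast b he 1] at h1
  simpa using h1.symm

end ArithLattice

/-! ### Eigenvalues of elements with unipotent image. -/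

namespace ArithLattice

open Matrix Polynomial

variable {N m : ℕ}

/-- The common zero condition defining `H`, read off on real points. -/
lemma mem_realPoints_iff {H : Subgroup (GL (Fin N) ℂ)}
    {S : Set (MvPolynomial (Fin N × Fin N) ℚ)}
    (hS : ∀ g : GL (Fin N) ℂ, g ∈ H ↔
      ∀ p ∈ S, MvPolynomial.aeval (fun ij : Fin N × Fin N => g ij.1 ij.2) p = 0)
    (g : GL (Fin N) ℝ) :
    g ∈ realPoints H ↔ ∀ p ∈ S, MvPolynomial.eval (entries g)
      (MvPolynomial.rename Sum.inl (MvPolynomial.map (algebraMap ℚ ℂ) p)) = 0 := by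
  rw [realPoints, Subgroup.mem_comap, hS]
  refine forall₂_congr fun p _ => ?_
  rw [MvPolynomial.eval_rename, MvPolynomial.eval_map, MvPolynomial.aeval_def]
  rfl

lemma mem_identityComponent_of_path (R : Subgroup (GL (Fin N) ℝ)) (p : ℝ → GL (Fin N) ℝ)
    (hp : Continuous p) (hp0 : p 0 = 1) (hR : ∀ t, p t ∈ R) (t : ℝ) :
    p t ∈ identityComponent R := by
  let q : ℝ → R := fun t => ⟨p t, hR t⟩
  have hq : Continuous q := hp.subtype_mk _
  have hq0 : q 0 = 1 := Subtype.ext hp0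
  refine ⟨q t, ?_, rfl⟩
  change q t ∈ connectedComponent (1 : R)
  have hconn : IsPreconnected (Set.range q) := isPreconnected_range hq
  exact hconn.subset_connectedComponent ⟨0, hq0⟩ ⟨t, rfl⟩

lemma exists_bound_of_isCompact_ker {L : Subgroup (GL (Fin N) ℝ)} (φ : L →* GL (Fin m) ℂ)
    (hφ : IsCompact (φ.ker : Set L)) :
    ∃ B : ℝ, ∀ g : L, φ g = 1 → ∀ i j, |(g : GL (Fin N) ℝ) i j| ≤ B := by
  have hcont : ∀ i j, Continuous fun g : L => (g : GL (Fin N) ℝ) i j := fun i j =>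
    (Units.continuous_val.comp continuous_subtype_val).matrix_elem i j
  have hb : ∀ i j, ∃ B : ℝ, ∀ g : L, φ g = 1 → |(g : GL (Fin N) ℝ) i j| ≤ B := fun i j => by
    obtain ⟨B, hB⟩ := hφ.exists_bound_of_continuousOn (hcont i j).continuousOn
    exact ⟨B, fun g hg => hB g hg⟩
  choose B hB using hb
  refine ⟨∑ i, ∑ j, |B i j|, fun g hg i j => ?_⟩
  calc |(g : GL (Fin N) ℝ) i j| ≤ B i j := hB i j g hg
    _ ≤ |B i j| := le_abs_self _
    _ ≤ ∑ j, |B i j| := Finset.single_le_sum (f := fun j => |B i j|) (fun _ _ => abs_nonneg _)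
        (Finset.mem_univ j)
    _ ≤ ∑ i, ∑ j, |B i j| := Finset.single_le_sum (f := fun i => ∑ j, |B i j|)
        (fun _ _ => Finset.sum_nonneg fun _ _ => abs_nonneg _) (Finset.mem_univ i)

lemma eq_one_of_rpow_le {r B : ℝ} (hr : 0 < r) (h : ∀ t : ℝ, r ^ t ≤ B) : r = 1 := by
  have key : ∀ s : ℝ, 1 < s → ¬ ∀ n : ℕ, s ^ n ≤ B := fun s hs hB => by
    obtain ⟨n, hn⟩ := pow_unbounded_of_one_lt B hs
    exact absurd (hB n) (not_le.2 hn)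
  rcases lt_trichotomy r 1 with h1 | h1 | h1
  · refine absurd (fun n => ?_) (key r⁻¹ ((one_lt_inv₀ hr).2 h1))
    have := h (-(n : ℝ))
    rwa [Real.rpow_neg hr.le, Real.rpow_natCast, ← inv_pow] at this
  · exact h1
  · refine absurd (fun n => ?_) (key r h1)
    simpa using h n

lemma norm_le_of_mulVec_eq_smul {A : Matrix (Fin N) (Fin N) ℂ} {B : ℝ}
    (hB : ∀ i j, ‖A i j‖ ≤ B) {v : Fin N → ℂ} (hv : v ≠ 0) {c : ℂ} (h : A *ᵥ v = c • v) :
    ‖c‖ ≤ N * B := by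
  obtain ⟨k, hk⟩ := Function.ne_iff.1 hv
  obtain ⟨i, -, hi⟩ := Finset.exists_max_image Finset.univ (fun i => ‖v i‖) ⟨k, Finset.mem_univ k⟩
  have hpos : 0 < ‖v i‖ := (norm_pos_iff.2 hk).trans_le (hi k (Finset.mem_univ k))
  have h1 := congrFun h i
  have hB0 : 0 ≤ B := (norm_nonneg _).trans (hB i i)
  have h2 : ‖c‖ * ‖v i‖ ≤ N * B * ‖v i‖ := by
    calc ‖c‖ * ‖v i‖ = ‖∑ j, A i j * v j‖ := by
          rw [← norm_mul, ← smul_eq_mul, ← Pi.smul_apply, ← h1]; rfl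
      _ ≤ ∑ j, ‖A i j * v j‖ := norm_sum_le _ _
      _ ≤ ∑ _j : Fin N, B * ‖v i‖ := Finset.sum_le_sum fun j _ => by
          rw [norm_mul]
          exact mul_le_mul (hB i j) (hi j (Finset.mem_univ j)) (norm_nonneg _) hB0
      _ = N * B * ‖v i‖ := by simp [mul_assoc]
  exact le_of_mul_le_mul_right h2 hpos

/-- If `φ` is regular with compact kernel, then an element which `φ` maps to a unipotent matrix has
all eigenvalues of absolute value one. -/
theorem norm_eq_one_of_isRoot_charpoly {H : Subgroup (GL (Fin N) ℂ)}
    (φ : identityComponent (realPoints H) →* GL (Fin m) ℂ)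
    (hH : IsAlgebraicOverRat H) (hφ : IsRegularHom φ)
    (hc : IsCompact (φ.ker : Set (identityComponent (realPoints H))))
    (h : identityComponent (realPoints H))
    (hu : IsNilpotent ((φ h : Matrix (Fin m) (Fin m) ℂ) - 1)) (z : ℂ)
    (hz : (toComplex N (h : GL (Fin N) ℝ) : Matrix (Fin N) (Fin N) ℂ).charpoly.IsRoot z) :
    ‖z‖ = 1 := by
  obtain ⟨S, hS⟩ := hH
  obtain ⟨p, hpc, hp0, hpoly, heig⟩ := exists_hyperbolic_path (h : GL (Fin N) ℝ)
  have hle : identityComponent (realPoints H) ≤ realPoints H := by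
    rintro _ ⟨g, -, rfl⟩
    exact g.2
  have hpR : ∀ t, p t ∈ realPoints H := fun t => by
    rw [mem_realPoints_iff hS]
    intro f hf
    -- The equations of `H` vanish on all powers of `h`, so `q = 0` serves.
    rw [hpoly _ 0 (fun n => ?_) t, Polynomial.eval_zero]
    rw [Polynomial.eval_zero]
    exact (mem_realPoints_iff hS _).1 (pow_mem (hle h.2) n) f hf
  have hpL := mem_identityComponent_of_path _ p hpc hp0 hpR
  obtain ⟨d, hd⟩ := hu
  have hker : ∀ t, φ ⟨p t, hpL t⟩ = 1 := fun t => by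
    ext i j
    obtain ⟨f, hf⟩ := hφ i j
    rw [hf]
    -- The coefficients of `φ (h ^ n) = φ h ^ n` are polynomial in `n` by unipotency; their values
    -- at `0` are those of the identity matrix.
    refine (hpoly f (powCurve (φ h : Matrix (Fin m) (Fin m) ℂ) d i j) (fun n => ?_) t).trans ?_
    · have h1 := hf (h ^ n)
      have h2 := congrFun (congrFun
        (powCurve_eval_natCast (φ h : Matrix (Fin m) (Fin m) ℂ) hd n) i) j
      rw [map_pow, Units.val_pow_eq_pow_val, ← h2] at h1
      exact h1.symm
    · have h2 := congrFun (congrFun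
        (powCurve_eval_natCast (φ h : Matrix (Fin m) (Fin m) ℂ) hd 0) i) j
      rw [Nat.cast_zero, pow_zero] at h2
      exact h2
  obtain ⟨B, hB⟩ := exists_bound_of_isCompact_ker φ hc
  obtain ⟨v, hv0, hv⟩ := heig z hz
  have hz0 : z ≠ 0 := by
    rintro rfl
    apply hv0
    apply Matrix.mulVec_injective_of_isUnit (toComplex N (p 1)).isUnit
    simpa using hv 1
  refine eq_one_of_rpow_le (B := N * B) (norm_pos_iff.2 hz0) fun t => ?_
  have hle2 := norm_le_of_mulVec_eq_smul (B := B) (fun i j => ?_) hv0 (hv t)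
  · rwa [Complex.norm_real, Real.norm_of_nonneg (Real.rpow_nonneg (norm_nonneg _) _)] at hle2
  · have := hB _ (hker t) i j
    simpa using! this

end ArithLattice

namespace ArithLattice

open Matrix Polynomial

/-! ### Groups of unipotent matrices -/

section Kolchin

variable {N : ℕ} {K : Type*} [Field K]

/-- The projection `e` onto the part where `x` is invertible is a polynomial in `x` without constant
term, so its trace vanishes. In characteristic zero an idempotent of trace zero is zero. -/
lemma isNilpotent_of_trace_pow_eq_zero [CharZero K] (x : Matrix (Fin N) (Fin N) K)
    (hx : ∀ k : ℕ, (x ^ (k + 1)).trace = 0) : IsNilpotent x := by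
  have htr : ∀ r : K[X], (aeval x (r * X)).trace = 0 := fun r => by
    induction r using Polynomial.induction_on' with
    | add p q hp hq => rw [add_mul, map_add, Matrix.trace_add, hp, hq, add_zero]
    | monomial n a =>
      rw [← C_mul_X_pow_eq_monomial, mul_assoc, ← pow_succ, map_mul, aeval_C, map_pow, aeval_X,
        ← Algebra.smul_def, Matrix.trace_smul, hx, smul_zero]
  obtain ⟨q, hq, hXq⟩ := Polynomial.exists_eq_pow_rootMultiplicity_mul_and_not_dvd x.charpoly
    x.charpoly_monic.ne_zero 0
  set a := x.charpoly.rootMultiplicity 0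
  rw [C_0, sub_zero] at hq hXq
  -- The exponent `a + 1` instead of `a` makes `e` divisible by `X` even when `a = 0`.
  have hcop : IsCoprime (X ^ (a + 1)) q :=
    ((irreducible_X.coprime_iff_not_dvd).2 hXq).pow_left
  obtain ⟨u, v, huv⟩ := hcop
  have hCH : aeval x (X ^ a * q) = 0 := by rw [← hq]; exact Matrix.aeval_self_charpoly x
  set e := aeval x (u * X ^ (a + 1)) with he
  have he1 : 1 - e = aeval x (v * q) := by
    rw [he, sub_eq_iff_eq_add, ← map_add, add_comm, huv, map_one]
  have hidem : IsIdempotentElem e := by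
    have : e * (1 - e) = 0 := by
      rw [he1, he, ← map_mul,
        show u * X ^ (a + 1) * (v * q) = u * X * v * (X ^ a * q) by ring, map_mul, hCH, mul_zero]
    rw [mul_sub, mul_one, sub_eq_zero] at this
    exact this.symm
  have htre : e.trace = 0 := by
    rw [he, pow_succ, ← mul_assoc]
    exact htr _
  have he0 : e = 0 := by
    have h1 : IsIdempotentElem (Matrix.toLin' e) := by
      rw [IsIdempotentElem, Module.End.mul_eq_comp, ← Matrix.toLin'_mul, hidem.eq]
    have h2 := (LinearMap.IsIdempotentElem.trace_eq_zero_iff h1).1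
      (by rw [Matrix.trace_toLin'_eq, htre])
    simpa using h2
  refine ⟨a, ?_⟩
  rw [he0, sub_zero] at he1
  calc x ^ a = x ^ a * 1 := (mul_one _).symm
    _ = aeval x (v * (X ^ a * q)) := by
      rw [he1, show v * (X ^ a * q) = X ^ a * (v * q) by ring, map_mul _ (X ^ a), map_pow, aeval_X]
    _ = 0 := by rw [map_mul, hCH, mul_zero]

/-- A finite dimensional algebra which is nil and equal to its square vanishes. -/
lemma eq_bot_of_mul_self_eq {A : Type*} [Ring A] [Algebra K A] [FiniteDimensional K A]
    (I : Submodule K A) (hI : I * I = I) (hnil : ∀ x ∈ I, IsNilpotent x) : I = ⊥ := by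
  let S := Algebra.adjoin K (I : Set A)
  have hsub : ∀ x ∈ I, x ∈ S := fun x hx => Algebra.subset_adjoin hx
  have hmul : ∀ s ∈ S, ∀ x ∈ I, s * x ∈ I := fun s hs => by
    induction hs using Algebra.adjoin_induction with
    | mem y hy => exact fun x hx => hI ▸ Submodule.mul_mem_mul hy hx
    | algebraMap r => exact fun x hx => by rw [← Algebra.smul_def]; exact I.smul_mem r hx
    | add a b _ _ ha hb => exact fun x hx => by rw [add_mul]; exact I.add_mem (ha x hx) (hb x hx)
    | mul a b _ _ ha hb => exact fun x hx => by rw [mul_assoc]; exact ha _ (hb x hx)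
  let J : Ideal S :=
    { carrier := {s | (s : A) ∈ I}
      zero_mem' := I.zero_mem
      add_mem' := fun ha hb => I.add_mem ha hb
      smul_mem' := fun s x hx => hmul s s.2 x hx }
  have : IsArtinianRing S := IsArtinianRing.of_finite K S
  obtain ⟨n, hn⟩ := IsArtinianRing.isNilpotent_jacobson_bot (R := S)
  -- Each `y * x` is nilpotent, so `1 + y * x` is invertible. The Jacobson radical of an Artinian
  -- ring is nilpotent, while `I = I * I` puts `I` in every power of `J`.
  have hJ : J ≤ Ideal.jacobson (⊥ : Ideal S) := fun x hx => by
    rw [Ideal.mem_jacobson_iff]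
    intro y
    have hyx : IsNilpotent (y * x) := by
      obtain ⟨k, hk⟩ := hnil _ (hmul y y.2 x hx)
      exact ⟨k, Subtype.ext (by simpa using hk)⟩
    obtain ⟨z, hz⟩ := hyx.isUnit_one_add.exists_left_inv
    refine ⟨z, ?_⟩
    rw [Ideal.mem_bot, sub_eq_zero, ← hz]
    noncomm_ring
  have hpow : ∀ k, ∀ x ∈ I, ∃ s ∈ J ^ (k + 1), (s : A) = x := fun k => by
    induction k with
    | zero => exact fun x hx => ⟨⟨x, hsub x hx⟩, by rw [zero_add, Submodule.pow_one]; exact hx, rfl⟩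
    | succ k ih =>
      intro x hx
      rw [← hI] at hx
      induction hx using Submodule.mul_induction_on' with
      | mem_mul_mem a ha b hb =>
        obtain ⟨s, hs, rfl⟩ := ih a ha
        refine ⟨s * ⟨b, hsub b hb⟩, ?_, rfl⟩
        rw [Submodule.pow_succ]
        exact Ideal.mul_mem_mul hs hb
      | add a _ b _ ha hb =>
        obtain ⟨s, hs, rfl⟩ := ha
        obtain ⟨t, ht, rfl⟩ := hb
        exact ⟨s + t, add_mem hs ht, rfl⟩
  rw [eq_bot_iff]
  intro x hx
  obtain ⟨s, hs, rfl⟩ := hpow n x hx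
  have : s ∈ (Ideal.jacobson (⊥ : Ideal S)) ^ n :=
    Ideal.pow_le_pow_right (Nat.le_succ n) (Ideal.pow_right_mono hJ _ hs)
  rw [hn] at this
  rw [Submodule.mem_bot]
  exact congrArg Subtype.val (show s = 0 from this)

end Kolchin

variable {N : ℕ}

/-- Integral matrices as rational matrices. -/
noncomputable abbrev matToRat (N : ℕ) : Matrix (Fin N) (Fin N) ℤ →+* Matrix (Fin N) (Fin N) ℚ :=
  (Int.castRingHom ℚ).mapMatrix

lemma matToRat_injective : Function.Injective (matToRat N) :=
  Matrix.map_injective Int.cast_injective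

/-- The rational span of the matrices `u - 1` for `u ∈ Δ`. -/
noncomputable def augSpan (Δ : Subgroup (GL (Fin N) ℤ)) :
    Submodule ℚ (Matrix (Fin N) (Fin N) ℚ) :=
  Submodule.span ℚ ((fun u : GL (Fin N) ℤ => matToRat N (u : Matrix (Fin N) (Fin N) ℤ) - 1) '' Δ)

lemma sub_one_mem_augSpan {Δ : Subgroup (GL (Fin N) ℤ)} {u : GL (Fin N) ℤ} (hu : u ∈ Δ) :
    matToRat N (u : Matrix (Fin N) (Fin N) ℤ) - 1 ∈ augSpan Δ :=
  Submodule.subset_span ⟨u, hu, rfl⟩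

/-- From `(u - 1)(v - 1) = (uv - 1) - (u - 1) - (v - 1)`. -/
lemma augSpan_mul_le (Δ : Subgroup (GL (Fin N) ℤ)) : augSpan Δ * augSpan Δ ≤ augSpan Δ := by
  conv_lhs => rw [augSpan, Submodule.span_mul_span]
  rw [Submodule.span_le]
  rintro _ ⟨_, ⟨u, hu, rfl⟩, _, ⟨v, hv, rfl⟩, rfl⟩
  have : (matToRat N (u : Matrix (Fin N) (Fin N) ℤ) - 1) *
      (matToRat N (v : Matrix (Fin N) (Fin N) ℤ) - 1) =
      (matToRat N ((u * v : GL (Fin N) ℤ) : Matrix (Fin N) (Fin N) ℤ) - 1) -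
        (matToRat N (u : Matrix (Fin N) (Fin N) ℤ) - 1) -
        (matToRat N (v : Matrix (Fin N) (Fin N) ℤ) - 1) := by
    rw [Units.val_mul, map_mul]
    noncomm_ring
  change (matToRat N (u : Matrix (Fin N) (Fin N) ℤ) - 1) *
      (matToRat N (v : Matrix (Fin N) (Fin N) ℤ) - 1) ∈ augSpan Δ
  rw [this]
  exact sub_mem (sub_mem (sub_one_mem_augSpan (mul_mem hu hv)) (sub_one_mem_augSpan hu))
    (sub_one_mem_augSpan hv)

lemma isNilpotent_matToRat_sub_one {u : GL (Fin N) ℤ}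
    (hu : IsNilpotent ((u : Matrix (Fin N) (Fin N) ℤ) - 1)) :
    IsNilpotent (matToRat N (u : Matrix (Fin N) (Fin N) ℤ) - 1) := by
  have := hu.map (matToRat N)
  rwa [map_sub, map_one] at this

/-- Nilpotency is not linear, but vanishing of the trace is: it passes to the span, which contains
all positive powers of its elements. -/
lemma isNilpotent_of_mem_augSpan {Δ : Subgroup (GL (Fin N) ℤ)}
    (hΔ : ∀ u ∈ Δ, IsNilpotent ((u : Matrix (Fin N) (Fin N) ℤ) - 1))
    {x : Matrix (Fin N) (Fin N) ℚ} (hx : x ∈ augSpan Δ) : IsNilpotent x := by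
  have htr : ∀ y ∈ augSpan Δ, y.trace = 0 := fun y hy => by
    have hle : augSpan Δ ≤ LinearMap.ker (Matrix.traceLinearMap (Fin N) ℚ ℚ) := by
      rw [augSpan, Submodule.span_le]
      rintro _ ⟨u, hu, rfl⟩
      exact (Matrix.isNilpotent_trace_of_isNilpotent
        (isNilpotent_matToRat_sub_one (hΔ u hu))).eq_zero
    exact hle hy
  have hpow : ∀ k : ℕ, x ^ (k + 1) ∈ augSpan Δ := fun k => by
    induction k with
    | zero => simpa using hx
    | succ k ih =>
      rw [pow_succ]
      exact augSpan_mul_le Δ (Submodule.mul_mem_mul ih hx)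
  exact isNilpotent_of_trace_pow_eq_zero x fun k => htr _ (hpow k)

lemma exists_clearing_denominators {ι : Type*} [Finite ι] (c : ι → ℚ) :
    ∃ q : ℕ, 0 < q ∧ ∃ a : ι → ℤ, ∀ i, (q : ℚ) * c i = a i := by
  have := Fintype.ofFinite ι
  refine ⟨∏ i, (c i).den, Finset.prod_pos fun i _ => (c i).den_pos, ?_⟩
  have : ∀ i, ∃ a : ℤ, ((∏ i, (c i).den : ℕ) : ℚ) * c i = a := fun i => by
    obtain ⟨k, hk⟩ := Finset.dvd_prod_of_mem (fun i => (c i).den) (Finset.mem_univ i)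
    refine ⟨k * (c i).num, ?_⟩
    rw [hk]
    push_cast
    rw [mul_comm ((c i).den : ℚ), mul_assoc, mul_comm ((c i).den : ℚ), Rat.mul_den_eq_num]
  choose a ha using this
  exact ⟨a, ha⟩

/-- A nontrivial group of integral unipotent matrices has a nonzero integral linear form which is
additive on it. -/
lemma exists_additive_form {Δ : Subgroup (GL (Fin N) ℤ)}
    (hΔ : ∀ u ∈ Δ, IsNilpotent ((u : Matrix (Fin N) (Fin N) ℤ) - 1)) (hne : augSpan Δ ≠ ⊥) :
    ∃ a : Fin N × Fin N → ℤ,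
      (∀ u ∈ Δ, ∀ v ∈ Δ, ∑ ij, a ij * ((u - 1 : Matrix (Fin N) (Fin N) ℤ) *
        (v - 1 : Matrix (Fin N) (Fin N) ℤ)) ij.1 ij.2 = 0) ∧
      ∃ u ∈ Δ, ∑ ij, a ij * (u - 1 : Matrix (Fin N) (Fin N) ℤ) ij.1 ij.2 ≠ 0 := by
  have hlt : ¬ augSpan Δ ≤ augSpan Δ * augSpan Δ := fun h => hne <|
    eq_bot_of_mul_self_eq _ (le_antisymm (augSpan_mul_le Δ) h)
      fun x hx => isNilpotent_of_mem_augSpan hΔ hx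
  obtain ⟨u, hu, hunot⟩ : ∃ u ∈ Δ,
      matToRat N (u : Matrix (Fin N) (Fin N) ℤ) - 1 ∉ augSpan Δ * augSpan Δ := by
    by_contra! hcon
    refine hlt ?_
    conv_lhs => rw [augSpan]
    rw [Submodule.span_le]
    rintro _ ⟨u, hu, rfl⟩
    exact hcon u hu
  -- A form killing `augSpan Δ * augSpan Δ` is additive on `Δ` through `u ↦ f (u - 1)`, because `uv
  -- - 1` equals `(u - 1) + (v - 1)` modulo products.
  obtain ⟨f, hfu, hfle⟩ := Submodule.exists_le_ker_of_notMem hunot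
  obtain ⟨q, hq, a, ha⟩ := exists_clearing_denominators
    fun ij : Fin N × Fin N => f (Matrix.single ij.1 ij.2 1)
  have hform : ∀ w : Matrix (Fin N) (Fin N) ℤ,
      ((∑ ij, a ij * w ij.1 ij.2 : ℤ) : ℚ) = q * f (matToRat N w) := fun w => by
    conv_rhs => rw [Matrix.matrix_eq_sum_single (matToRat N w)]
    rw [map_sum, Finset.mul_sum, Int.cast_sum, Fintype.sum_prod_type]
    refine Finset.sum_congr rfl fun i _ => ?_
    rw [map_sum, Finset.mul_sum]
    refine Finset.sum_congr rfl fun j _ => ?_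
    have : Matrix.single i j (matToRat N w i j) = ((w i j : ℤ) : ℚ) • Matrix.single i j (1 : ℚ) := by
      simp
    rw [this, map_smul, smul_eq_mul, Int.cast_mul, ← ha]
    ring
  have hq0 : (q : ℚ) ≠ 0 := by exact_mod_cast hq.ne'
  refine ⟨a, fun u hu v hv => ?_, u, hu, fun h0 => ?_⟩
  · have h1 := hform ((u - 1 : Matrix (Fin N) (Fin N) ℤ) * (v - 1 : Matrix (Fin N) (Fin N) ℤ))
    have h2 : f (matToRat N ((u - 1 : Matrix (Fin N) (Fin N) ℤ) *
        (v - 1 : Matrix (Fin N) (Fin N) ℤ))) = 0 := by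
      apply hfle
      rw [map_mul, map_sub, map_sub, map_one]
      exact Submodule.mul_mem_mul (sub_one_mem_augSpan hu) (sub_one_mem_augSpan hv)
    rw [h2, mul_zero] at h1
    exact_mod_cast h1
  · have h1 := hform (u - 1 : Matrix (Fin N) (Fin N) ℤ)
    rw [h0, map_sub, map_one, Int.cast_zero] at h1
    exact mul_ne_zero hq0 hfu h1.symm

end ArithLattice

/-! ### Congruence subgroups and roots in groups of integral unipotent matrices. -/

namespace ArithLattice

open Matrix Polynomial

variable {N : ℕ}

/-- The principal congruence subgroup of level `n` in `GL(N, ℤ)`. -/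
noncomputable def congruenceSubgroup (N n : ℕ) : Subgroup (GL (Fin N) ℤ) :=
  (GeneralLinearGroup.map (Int.castRingHom (ZMod n))).ker

lemma mem_congruenceSubgroup_iff {n : ℕ} {u : GL (Fin N) ℤ} :
    u ∈ congruenceSubgroup N n ↔
      ∃ w : Matrix (Fin N) (Fin N) ℤ, (u : Matrix (Fin N) (Fin N) ℤ) = 1 + (n : ℤ) • w := by
  rw [congruenceSubgroup, MonoidHom.mem_ker]
  constructor
  · intro h
    have hdvd : ∀ i j, (n : ℤ) ∣ (u : Matrix (Fin N) (Fin N) ℤ) i j -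
        (1 : Matrix (Fin N) (Fin N) ℤ) i j := fun i j => by
      rw [← ZMod.intCast_eq_intCast_iff_dvd_sub]
      have := congrArg (fun g : GL (Fin N) (ZMod n) => (g : Matrix (Fin N) (Fin N) (ZMod n)) i j) h
      have h1 : (((u : Matrix (Fin N) (Fin N) ℤ) i j : ℤ) : ZMod n) =
        (1 : Matrix (Fin N) (Fin N) (ZMod n)) i j := this
      rw [h1]
      rcases eq_or_ne i j with rfl | hij
      · simp
      · simp [hij]
    choose w hw using hdvd
    refine ⟨Matrix.of w, ?_⟩
    ext i j
    rw [Matrix.add_apply, Matrix.smul_apply, smul_eq_mul, Matrix.of_apply, ← hw]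
    ring
  · rintro ⟨w, hw⟩
    ext i j
    change (((u : Matrix (Fin N) (Fin N) ℤ) i j : ℤ) : ZMod n) =
      (1 : Matrix (Fin N) (Fin N) (ZMod n)) i j
    rw [hw, Matrix.add_apply, Matrix.smul_apply, smul_eq_mul]
    rcases eq_or_ne i j with rfl | hij
    · simp
    · simp [hij]

lemma congruenceSubgroup_le_of_dvd {k n : ℕ} (h : k ∣ n) :
    congruenceSubgroup N n ≤ congruenceSubgroup N k := fun u hu => by
  obtain ⟨w, hw⟩ := mem_congruenceSubgroup_iff.1 hu
  obtain ⟨c, rfl⟩ := h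
  refine mem_congruenceSubgroup_iff.2 ⟨(c : ℤ) • w, ?_⟩
  rw [hw, smul_smul]
  push_cast
  rfl

instance finite_GL_zmod (n : ℕ) [NeZero n] : Finite (GL (Fin N) (ZMod n)) :=
  inferInstanceAs (Finite (Matrix (Fin N) (Fin N) (ZMod n))ˣ)

instance congruenceSubgroup_finiteIndex (n : ℕ) [NeZero n] :
    (congruenceSubgroup N n).FiniteIndex := by
  rw [congruenceSubgroup]
  infer_instance

lemma zpow_mem_congruenceSubgroup (n : ℕ) (g : GL (Fin N) ℤ) (a : ℤ)
    (ha : (Nat.card (GL (Fin N) (ZMod n)) : ℤ) ∣ a) : g ^ a ∈ congruenceSubgroup N n := by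
  obtain ⟨b, rfl⟩ := ha
  rw [congruenceSubgroup, MonoidHom.mem_ker, _root_.zpow_mul, zpow_natCast, map_zpow, map_pow,
    pow_card_eq_one', _root_.one_zpow]

lemma pow_card_eq_zero_of_isNilpotent {M : Matrix (Fin N) (Fin N) ℤ} (h : IsNilpotent M) :
    M ^ N = 0 := by
  have h1 := (Matrix.isNilpotent_charpoly_sub_pow_of_isNilpotent h).eq_zero
  have h2 := Matrix.aeval_self_charpoly M
  rw [sub_eq_zero.1 h1] at h2
  simpa using h2

lemma map_eval_mul {K : Type*} [CommRing K] (x y : Matrix (Fin N) (Fin N) K[X]) (t : K) :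
    (x * y).map (Polynomial.eval t) = x.map (Polynomial.eval t) * y.map (Polynomial.eval t) := by
  exact map_mul (Polynomial.evalRingHom t).mapMatrix x y

lemma map_eval_pow {K : Type*} [CommRing K] (x : Matrix (Fin N) (Fin N) K[X]) (n : ℕ) (t : K) :
    (x ^ n).map (Polynomial.eval t) = x.map (Polynomial.eval t) ^ n := by
  exact map_pow (Polynomial.evalRingHom t).mapMatrix x n

lemma map_comp_map_eval {K : Type*} [CommRing K] (x : Matrix (Fin N) (Fin N) K[X]) (s : K[X])
    (t : K) : (x.map fun p => p.comp s).map (Polynomial.eval t) =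
      x.map (Polynomial.eval (s.eval t)) := by
  ext i j
  simp [Polynomial.eval_comp]

lemma infinite_range_natCast_rat : (Set.range fun n : ℕ => (n : ℚ)).Infinite :=
  Set.infinite_range_of_injective Nat.cast_injective

/-- For negative exponents: the polynomial identity `P(t) g ^ n = P(t + n)`, valid at natural `t`,
is evaluated at `t = -n`. -/
lemma powCurve_eval_intCast (g : GL (Fin N) ℤ) {d : ℕ}
    (hd : (matToRat N (g : Matrix (Fin N) (Fin N) ℤ) - 1) ^ d = 0) (a : ℤ) :
    (powCurve (matToRat N (g : Matrix (Fin N) (Fin N) ℤ)) d).map (Polynomial.eval (a : ℚ)) =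
      matToRat N ((g ^ a : GL (Fin N) ℤ) : Matrix (Fin N) (Fin N) ℤ) := by
  set P := powCurve (matToRat N (g : Matrix (Fin N) (Fin N) ℤ)) d with hP
  have hnat : ∀ n : ℕ, P.map (Polynomial.eval (n : ℚ)) =
      matToRat N ((g ^ n : GL (Fin N) ℤ) : Matrix (Fin N) (Fin N) ℤ) := fun n => by
    rw [hP, powCurve_eval_natCast _ hd, Units.val_pow_eq_pow_val, map_pow]
  obtain ⟨n, rfl | rfl⟩ := a.eq_nat_or_neg
  · simpa using hnat n
  · have key : P * (matToRat N ((g ^ n : GL (Fin N) ℤ) : Matrix (Fin N) (Fin N) ℤ)).map C =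
        P.map fun p => p.comp (X + C (n : ℚ)) := by
      refine matrix_polynomial_ext infinite_range_natCast_rat ?_
      rintro _ ⟨k, rfl⟩
      have hC : ((matToRat N ((g ^ n : GL (Fin N) ℤ) : Matrix (Fin N) (Fin N) ℤ)).map C).map
          (Polynomial.eval (k : ℚ)) =
          matToRat N ((g ^ n : GL (Fin N) ℤ) : Matrix (Fin N) (Fin N) ℤ) := by
        ext i j; simp
      rw [map_eval_mul, hC, map_comp_map_eval, hnat, ← map_mul, ← Units.val_mul, ← pow_add, ← hnat]
      simp
    have h1 := congrArg (fun x => x.map (Polynomial.eval (-(n : ℚ)))) key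
    simp only [map_eval_mul, map_comp_map_eval] at h1
    have hC : ((matToRat N ((g ^ n : GL (Fin N) ℤ) : Matrix (Fin N) (Fin N) ℤ)).map C).map
        (Polynomial.eval (-(n : ℚ))) =
        matToRat N ((g ^ n : GL (Fin N) ℤ) : Matrix (Fin N) (Fin N) ℤ) := by
      ext i j; simp
    have h0 := hnat 0
    rw [Nat.cast_zero, pow_zero, Units.val_one, map_one] at h0
    rw [hC, eval_add, eval_X, eval_C, neg_add_cancel, h0] at h1
    have h2 : matToRat N ((g ^ n : GL (Fin N) ℤ) : Matrix (Fin N) (Fin N) ℤ) *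
        matToRat N ((g ^ (-(n : ℤ)) : GL (Fin N) ℤ) : Matrix (Fin N) (Fin N) ℤ) = 1 := by
      rw [← map_mul, ← Units.val_mul, ← zpow_natCast, ← _root_.zpow_add, add_neg_cancel, zpow_zero,
        Units.val_one, map_one]
    rw [Int.cast_neg, Int.cast_natCast]
    exact left_inv_eq_right_inv h1 h2

/-- A group of integral unipotent matrices is congruence closed in its Zariski closure: rational
points of polynomial curves in `Δ` which lie in a small congruence subgroup belong to `Δ`. -/
theorem exists_level_of_curves (Δ : Subgroup (GL (Fin N) ℤ))
    (hΔ : ∀ u ∈ Δ, IsNilpotent ((u : Matrix (Fin N) (Fin N) ℤ) - 1)) :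
    ∃ n : ℕ, 0 < n ∧ ∀ x : Matrix (Fin N) (Fin N) ℚ[X],
      (∀ k : ℕ, ∃ u ∈ Δ, x.map (Polynomial.eval (k : ℚ)) =
        matToRat N (u : Matrix (Fin N) (Fin N) ℤ)) →
      ∀ (t : ℚ), ∀ u ∈ congruenceSubgroup N n,
        x.map (Polynomial.eval t) = matToRat N (u : Matrix (Fin N) (Fin N) ℤ) → u ∈ Δ := by
  induction hdim : Module.finrank ℚ (augSpan Δ) using Nat.strong_induction_on generalizing Δ with
  | _ r ih =>
  by_cases hbot : augSpan Δ = ⊥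
  · refine ⟨1, one_pos, fun x hx t u _ hu => ?_⟩
    have hx1 : x = 1 := by
      refine matrix_polynomial_ext infinite_range_natCast_rat ?_
      rintro _ ⟨k, rfl⟩
      obtain ⟨v, hv, hxv⟩ := hx k
      have := sub_one_mem_augSpan hv
      rw [hbot, Submodule.mem_bot, sub_eq_zero] at this
      rw [hxv, this, Matrix.map_one _ eval_zero eval_one]
    rw [hx1, Matrix.map_one _ eval_zero eval_one, ← map_one (matToRat N)] at hu
    have : u = 1 := Units.ext (matToRat_injective hu).symm
    rw [this]
    exact Δ.one_mem
  obtain ⟨a, ha, u₀, hu₀, hau₀⟩ := exists_additive_form hΔ hbot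
  let χ : Matrix (Fin N) (Fin N) ℤ →+ ℤ :=
    ⟨⟨fun w => ∑ ij, a ij * w ij.1 ij.2, by simp⟩, fun v w => by
      simp [mul_add, Finset.sum_add_distrib]⟩
  have hχ : ∀ w, χ w = ∑ ij, a ij * w ij.1 ij.2 := fun w => rfl
  have hχmul : ∀ u ∈ Δ, ∀ v ∈ Δ, χ (((u * v : GL (Fin N) ℤ) : Matrix (Fin N) (Fin N) ℤ) - 1) =
      χ ((u : Matrix (Fin N) (Fin N) ℤ) - 1) + χ ((v : Matrix (Fin N) (Fin N) ℤ) - 1) :=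
    fun u hu v hv => by
    have h0 : χ (((u : Matrix (Fin N) (Fin N) ℤ) - 1) * ((v : Matrix (Fin N) (Fin N) ℤ) - 1)) = 0 :=
      ha u hu v hv
    have : ((u * v : GL (Fin N) ℤ) : Matrix (Fin N) (Fin N) ℤ) - 1 =
        ((u : Matrix (Fin N) (Fin N) ℤ) - 1) * ((v : Matrix (Fin N) (Fin N) ℤ) - 1) +
        (((u : Matrix (Fin N) (Fin N) ℤ) - 1) + ((v : Matrix (Fin N) (Fin N) ℤ) - 1)) := by
      rw [Units.val_mul]; noncomm_ring
    rw [this, map_add, h0, zero_add, map_add]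
  have hχone : χ (((1 : GL (Fin N) ℤ) : Matrix (Fin N) (Fin N) ℤ) - 1) = 0 := by simp
  have hχinv : ∀ u ∈ Δ, χ (((u⁻¹ : GL (Fin N) ℤ) : Matrix (Fin N) (Fin N) ℤ) - 1) =
      -χ ((u : Matrix (Fin N) (Fin N) ℤ) - 1) := fun u hu => by
    have := hχmul _ (inv_mem hu) _ hu
    rw [inv_mul_cancel, hχone] at this
    linarith
  have hχzpow : ∀ u ∈ Δ, ∀ b : ℤ, χ (((u ^ b : GL (Fin N) ℤ) : Matrix (Fin N) (Fin N) ℤ) - 1) =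
      b * χ ((u : Matrix (Fin N) (Fin N) ℤ) - 1) := fun u hu b => by
    induction b using Int.induction_on with
    | zero => rw [zpow_zero, hχone, zero_mul]
    | succ b hb =>
      rw [_root_.zpow_add_one, hχmul _ (zpow_mem hu _) _ hu, hb]
      ring
    | pred b hb =>
      rw [_root_.zpow_sub_one, hχmul _ (zpow_mem hu _) _ (inv_mem hu), hb, hχinv u hu]
      ring
  let R : AddSubgroup ℤ :=
    { carrier := {k | ∃ u ∈ Δ, χ ((u : Matrix (Fin N) (Fin N) ℤ) - 1) = k}
      zero_mem' := ⟨1, Δ.one_mem, hχone⟩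
      add_mem' := by
        rintro _ _ ⟨u, hu, rfl⟩ ⟨v, hv, rfl⟩
        exact ⟨u * v, mul_mem hu hv, hχmul u hu v hv⟩
      neg_mem' := by
        rintro _ ⟨u, hu, rfl⟩
        exact ⟨u⁻¹, inv_mem hu, hχinv u hu⟩ }
  -- The character `u ↦ χ (u - 1)` has image `dℤ`, attained at `g`; its kernel `Δ₂` has smaller
  -- span, so the induction applies to it.
  obtain ⟨d, hd⟩ := Int.subgroup_cyclic R
  have hR : ∀ k, k ∈ R ↔ ∃ b : ℤ, k = b * d := fun k => by
    rw [hd, AddSubgroup.mem_closure_singleton]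
    simp [eq_comm]
  obtain ⟨g, hg, hgd⟩ : ∃ g ∈ Δ, χ ((g : Matrix (Fin N) (Fin N) ℤ) - 1) = d :=
    (hR d).2 ⟨1, (one_mul d).symm⟩
  have hdvd : ∀ u ∈ Δ, ∃ b : ℤ, χ ((u : Matrix (Fin N) (Fin N) ℤ) - 1) = b * d := fun u hu =>
    (hR _).1 ⟨u, hu, rfl⟩
  have hd0 : d ≠ 0 := by
    rintro rfl
    obtain ⟨b, hb⟩ := hdvd u₀ hu₀
    exact hau₀ (by rw [← hχ, hb, mul_zero])
  have hdQ : (d : ℚ) ≠ 0 := by exact_mod_cast hd0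
  let Δ₂ : Subgroup (GL (Fin N) ℤ) :=
    { carrier := {u | u ∈ Δ ∧ χ ((u : Matrix (Fin N) (Fin N) ℤ) - 1) = 0}
      one_mem' := ⟨Δ.one_mem, hχone⟩
      mul_mem' := by
        rintro u v ⟨hu, hu'⟩ ⟨hv, hv'⟩
        exact ⟨mul_mem hu hv, by rw [hχmul u hu v hv, hu', hv', add_zero]⟩
      inv_mem' := by
        rintro u ⟨hu, hu'⟩
        exact ⟨inv_mem hu, by rw [hχinv u hu, hu', neg_zero]⟩ }
  have hΔ₂ : ∀ {u}, u ∈ Δ₂ ↔ u ∈ Δ ∧ χ ((u : Matrix (Fin N) (Fin N) ℤ) - 1) = 0 := Iff.rfl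
  have hlt : augSpan Δ₂ < augSpan Δ := by
    let c : Matrix (Fin N) (Fin N) ℚ →ₗ[ℚ] ℚ :=
      { toFun := fun w => ∑ ij, (a ij : ℚ) * w ij.1 ij.2
        map_add' := fun v w => by simp [mul_add, Finset.sum_add_distrib]
        map_smul' := fun r w => by
          simp only [Matrix.smul_apply, smul_eq_mul, RingHom.id_apply, Finset.mul_sum]
          exact Finset.sum_congr rfl fun _ _ => by ring }
    have hc : ∀ w : Matrix (Fin N) (Fin N) ℤ, c (matToRat N w) = χ w := fun w => by
      rw [hχ]; simp [c]
    have hker : augSpan Δ₂ ≤ LinearMap.ker c := by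
      rw [augSpan, Submodule.span_le]
      rintro _ ⟨u, hu, rfl⟩
      change c (matToRat N (u : Matrix (Fin N) (Fin N) ℤ) - 1) = 0
      rw [← map_one (matToRat N), ← map_sub, hc, hu.2, Int.cast_zero]
    refine lt_of_le_of_ne (Submodule.span_mono (Set.image_mono fun u hu => hu.1)) fun heq => ?_
    have hmem : matToRat N (g : Matrix (Fin N) (Fin N) ℤ) - 1 ∈ augSpan Δ₂ :=
      heq ▸ sub_one_mem_augSpan hg
    have h0 : c (matToRat N (g : Matrix (Fin N) (Fin N) ℤ) - 1) = 0 := hker hmem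
    rw [← map_one (matToRat N), ← map_sub, hc, hgd] at h0
    exact hdQ h0
  obtain ⟨n₂, hn₂, H₂⟩ := ih _ (hdim ▸ Submodule.finrank_lt_finrank_of_lt hlt) Δ₂
    (fun u hu => hΔ u hu.1) rfl
  have : NeZero n₂ := ⟨hn₂.ne'⟩
  set e := Nat.card (GL (Fin N) (ZMod n₂)) with he
  have he0 : 0 < e := Nat.card_pos
  -- The factors `d` and `e` make `χ (u - 1) = b d` with `e ∣ b`, so that `g ^ (-b) ≡ 1` mod `n₂`;
  -- the factor `n₂` makes `u ≡ 1` mod `n₂`.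
  refine ⟨d.natAbs * e * n₂, by positivity, fun x hx t u hu hxu => ?_⟩
  obtain ⟨r₁, hgr⟩ := isNilpotent_matToRat_sub_one (hΔ g hg)
  -- The curve `y = g ^ s * x` corrects `x` so that its values at natural numbers lie in the kernel
  -- `Δ₂`.
  let s : ℚ[X] := C (-(d : ℚ)⁻¹) * ∑ ij, C (a ij : ℚ) * (x - 1) ij.1 ij.2
  let y : Matrix (Fin N) (Fin N) ℚ[X] :=
    ((powCurve (matToRat N (g : Matrix (Fin N) (Fin N) ℤ)) r₁).map fun p => p.comp s) * x
  have hs : ∀ (τ : ℚ) (v : GL (Fin N) ℤ) (b : ℤ),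
      x.map (Polynomial.eval τ) = matToRat N (v : Matrix (Fin N) (Fin N) ℤ) →
      χ ((v : Matrix (Fin N) (Fin N) ℤ) - 1) = b * d →
      y.map (Polynomial.eval τ) =
        matToRat N ((g ^ (-b) * v : GL (Fin N) ℤ) : Matrix (Fin N) (Fin N) ℤ) :=
    fun τ v b hv hb => by
    have hent : ∀ i j, ((x - 1) i j).eval τ =
        ((((v : Matrix (Fin N) (Fin N) ℤ) - 1) i j : ℤ) : ℚ) := fun i j => by
      have := congrFun (congrFun hv i) j
      have h1 : (x i j).eval τ = (((v : Matrix (Fin N) (Fin N) ℤ) i j : ℤ) : ℚ) := this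
      rw [Matrix.sub_apply, eval_sub, h1, Matrix.sub_apply]
      rcases eq_or_ne i j with rfl | hij
      · simp
      · simp [hij]
    have hsτ : s.eval τ = ((-b : ℤ) : ℚ) := by
      have : (∑ ij : Fin N × Fin N, (a ij : ℚ) *
          ((((v : Matrix (Fin N) (Fin N) ℤ) - 1) ij.1 ij.2 : ℤ) : ℚ)) = (b : ℚ) * d := by
        exact_mod_cast hb
      simp only [s, eval_mul, eval_C, eval_finsetSum, hent]
      rw [this]
      push_cast
      field_simp
    rw [map_eval_mul, map_comp_map_eval, hsτ, powCurve_eval_intCast g hgr, hv, Units.val_mul,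
      map_mul]
  have hy : ∀ k : ℕ, ∃ u ∈ Δ₂, y.map (Polynomial.eval (k : ℚ)) =
      matToRat N (u : Matrix (Fin N) (Fin N) ℤ) := fun k => by
    obtain ⟨v, hv, hxv⟩ := hx k
    obtain ⟨b, hb⟩ := hdvd v hv
    refine ⟨g ^ (-b) * v, hΔ₂.2 ⟨mul_mem (zpow_mem hg _) hv, ?_⟩, hs _ v b hxv hb⟩
    rw [hχmul _ (zpow_mem hg _) _ hv, hχzpow g hg, hgd, hb]
    ring
  obtain ⟨w, hw⟩ := mem_congruenceSubgroup_iff.1 hu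
  obtain ⟨ε, hε⟩ : ∃ ε : ℤ, (d.natAbs : ℤ) = ε * d := by
    obtain ⟨ε, hε⟩ := Int.dvd_natAbs_self (a := d)
    exact ⟨ε, by rw [hε, mul_comm]⟩
  have hub : χ ((u : Matrix (Fin N) (Fin N) ℤ) - 1) = (e * (ε * n₂ * χ w)) * d := by
    rw [hw, add_sub_cancel_left, map_zsmul, smul_eq_mul]
    push_cast
    rw [← Int.natCast_natAbs, hε]
    ring
  have hmem : g ^ (-((e : ℤ) * (ε * n₂ * χ w))) * u ∈ congruenceSubgroup N n₂ :=
    mul_mem (zpow_mem_congruenceSubgroup n₂ g _ ((Dvd.intro _ rfl).neg_right))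
      (congruenceSubgroup_le_of_dvd (Dvd.intro_left _ rfl) hu)
  have hfin := (H₂ y hy t _ hmem (hs t u _ hxu hub)).1
  exact (Subgroup.mul_mem_cancel_left Δ (zpow_mem hg _)).1 hfin

/-- In a group `Δ` of integral unipotent matrices, the elements of a small congruence subgroup are
`D`-th powers. -/
theorem exists_level_of_powers (Δ : Subgroup (GL (Fin N) ℤ))
    (hΔ : ∀ u ∈ Δ, IsNilpotent ((u : Matrix (Fin N) (Fin N) ℤ) - 1)) {D : ℕ} (hD : D ≠ 0) :
    ∃ n : ℕ, 0 < n ∧ ∀ h ∈ Δ, h ∈ congruenceSubgroup N n → ∃ w ∈ Δ, w ^ D = h := by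
  obtain ⟨n₀, hn₀, H⟩ := exists_level_of_curves Δ hΔ
  -- `q` clears the denominators of the binomial coefficients of `1/D` up to index `N`; higher terms
  -- vanish because `(h - 1) ^ N = 0`.
  obtain ⟨q, hq, a, ha⟩ := exists_clearing_denominators
    fun j : Fin (N + 1) => (binomPoly ℚ j).eval ((D : ℚ)⁻¹)
  refine ⟨n₀ * q, by positivity, fun h hh hcong => ?_⟩
  obtain ⟨w, hw⟩ := mem_congruenceSubgroup_iff.1 hcong
  have hdZ : ((h : Matrix (Fin N) (Fin N) ℤ) - 1) ^ (N + 1) = 0 := by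
    rw [pow_succ, pow_card_eq_zero_of_isNilpotent (hΔ h hh), zero_mul]
  have hd : (matToRat N (h : Matrix (Fin N) (Fin N) ℤ) - 1) ^ (N + 1) = 0 := by
    rw [← map_one (matToRat N), ← map_sub, ← map_pow, hdZ, map_zero]
  set P := powCurve (matToRat N (h : Matrix (Fin N) (Fin N) ℤ)) (N + 1) with hP
  have hPnat : ∀ k : ℕ, P.map (Polynomial.eval (k : ℚ)) =
      matToRat N (h : Matrix (Fin N) (Fin N) ℤ) ^ k := powCurve_eval_natCast _ hd
  -- With `h - 1 = n₀ q w`, each term of positive degree in the series for `h ^ (1/D)` spends one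
  -- `q` on its denominator and retains a factor `n₀`.
  let w' : Matrix (Fin N) (Fin N) ℤ :=
    ∑ j : Fin N, (a j.succ * ((n₀ * q : ℕ) : ℤ) ^ (j : ℕ)) • w ^ ((j : ℕ) + 1)
  have hroot : P.map (Polynomial.eval ((D : ℚ)⁻¹)) = matToRat N (1 + (n₀ : ℤ) • w') := by
    rw [hP, powCurve_map_eval, Finset.sum_range, Fin.sum_univ_succ, map_add, map_one]
    congr 1
    · simp [binomPoly]
    · rw [map_zsmul, map_sum, Finset.smul_sum]
      refine Finset.sum_congr rfl fun j _ => ?_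
      have h1 : matToRat N (h : Matrix (Fin N) (Fin N) ℤ) - 1 =
          ((n₀ * q : ℕ) : ℚ) • matToRat N w := by
        rw [hw, map_add, map_one, add_sub_cancel_left, map_zsmul, ← Int.cast_smul_eq_zsmul ℚ]
        simp
      rw [h1, _root_.smul_pow, map_zsmul, map_pow, ← Int.cast_smul_eq_zsmul ℚ,
        ← Int.cast_smul_eq_zsmul ℚ, smul_smul, smul_smul]
      congr 1
      have h2 := ha j.succ
      push_cast at h2 ⊢
      rw [← h2, Fin.val_succ, pow_succ]
      ring
  have hpowD : P ^ D = P.map fun p => p.comp (C (D : ℚ) * X) := by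
    refine matrix_polynomial_ext infinite_range_natCast_rat ?_
    rintro _ ⟨k, rfl⟩
    rw [map_eval_pow, map_comp_map_eval, hPnat, ← pow_mul, mul_comm k D, ← hPnat]
    simp
  have hWD : (1 + (n₀ : ℤ) • w') ^ D = (h : Matrix (Fin N) (Fin N) ℤ) := by
    apply matToRat_injective
    have h1 := congrArg (fun x => x.map (Polynomial.eval ((D : ℚ)⁻¹))) hpowD
    simp only [map_eval_pow, map_comp_map_eval] at h1
    have h2 := hPnat 1
    rw [Nat.cast_one, pow_one] at h2
    rw [map_pow, ← hroot, h1, eval_mul, eval_C, eval_X, mul_inv_cancel₀ (by exact_mod_cast hD), h2]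
  obtain ⟨W, hW⟩ : IsUnit (1 + (n₀ : ℤ) • w') := by
    rw [← isUnit_pow_iff hD, hWD]
    exact h.isUnit
  refine ⟨W, H P (fun k => ⟨h ^ k, pow_mem hh k, ?_⟩) ((D : ℚ)⁻¹) W
    (mem_congruenceSubgroup_iff.2 ⟨w', hW⟩) ?_, ?_⟩
  · rw [hPnat, Units.val_pow_eq_pow_val, map_pow]
  · rw [hroot, hW]
  · apply Units.ext
    rw [Units.val_pow_eq_pow_val, hW, hWD]

end ArithLattice

/-! ### The product of `Γ` with a deep normalized subgroup. -/

namespace ArithLattice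

open Matrix

variable {N m : ℕ}

lemma isNilpotent_sub_one_of_isUnipotent {U : Subgroup (GL (Fin m) ℂ)} (hU : IsUnipotent U)
    {g : GL (Fin m) ℂ} (hg : g ∈ U) : IsNilpotent ((g : Matrix (Fin m) (Fin m) ℂ) - 1) := by
  obtain ⟨P, hP⟩ := hU
  obtain ⟨hdiag, hlow⟩ := hP g hg
  set T : Matrix (Fin m) (Fin m) ℂ :=
    ((P * g * P⁻¹ : GL (Fin m) ℂ) : Matrix (Fin m) (Fin m) ℂ) with hT
  have htri : (T - 1).BlockTriangular id := fun i j hij => by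
    have hij' : j < i := hij
    rw [Matrix.sub_apply, hlow i j hij', Matrix.one_apply_ne hij'.ne', sub_zero]
  have hnil : IsNilpotent (T - 1) := by
    refine ⟨Fintype.card (Fin m), ?_⟩
    have h1 : (T - 1).charpoly = Polynomial.X ^ Fintype.card (Fin m) := by
      rw [Matrix.charpoly_of_isUpperTriangular _ htri]
      have : ∀ i, (T - 1) i i = 0 := fun i => by
        rw [Matrix.sub_apply, hdiag i, Matrix.one_apply_eq, sub_self]
      simp [this]
    have h2 := Matrix.aeval_self_charpoly (T - 1)
    rw [h1] at h2
    simpa using h2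
  have hconj : (g : Matrix (Fin m) (Fin m) ℂ) - 1 =
      ((P⁻¹ : GL (Fin m) ℂ) : Matrix (Fin m) (Fin m) ℂ) * (T - 1) *
        (P : Matrix (Fin m) (Fin m) ℂ) := by
    have h1 : ((P⁻¹ : GL (Fin m) ℂ) : Matrix (Fin m) (Fin m) ℂ) * T *
        (P : Matrix (Fin m) (Fin m) ℂ) = g := by
      rw [hT, ← Units.val_mul, ← Units.val_mul]
      congr 1
      group
    rw [mul_sub, sub_mul, h1, mul_one, ← Units.val_mul, inv_mul_cancel, Units.val_one]
  obtain ⟨k, hk⟩ := hnil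
  refine ⟨k, ?_⟩
  rw [hconj, Units.conj_pow', hk, mul_zero, zero_mul]

/-- Conjugates of unipotent matrices are unipotent. -/
lemma isNilpotent_conj_sub_one {g a : GL (Fin m) ℂ}
    (ha : IsNilpotent ((a : Matrix (Fin m) (Fin m) ℂ) - 1)) :
    IsNilpotent (((g * a * g⁻¹ : GL (Fin m) ℂ) : Matrix (Fin m) (Fin m) ℂ) - 1) := by
  obtain ⟨k, hk⟩ := ha
  refine ⟨k, ?_⟩
  have : ((g * a * g⁻¹ : GL (Fin m) ℂ) : Matrix (Fin m) (Fin m) ℂ) - 1 =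
      (g : Matrix (Fin m) (Fin m) ℂ) * ((a : Matrix (Fin m) (Fin m) ℂ) - 1) *
        ((g⁻¹ : GL (Fin m) ℂ) : Matrix (Fin m) (Fin m) ℂ) := by
    rw [mul_sub, sub_mul, mul_one, ← Units.val_mul, ← Units.val_mul, ← Units.val_mul,
      mul_inv_cancel, Units.val_one]
  rw [this, Units.conj_pow, hk, mul_zero, zero_mul]

lemma exists_pow_mem_of_isFiniteRelIndex {A : Type*} [Group A] {H K : Subgroup A}
    (h : H.relIndex K ≠ 0) : ∃ E : ℕ, E ≠ 0 ∧ ∀ x ∈ K, x ^ E ∈ H := by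
  have hfin : (H.subgroupOf K).FiniteIndex := ⟨h⟩
  refine ⟨(H.subgroupOf K).normalCore.index, Subgroup.FiniteIndex.index_ne_zero, fun x hx => ?_⟩
  have := Subgroup.pow_index_mem (H.subgroupOf K).normalCore (⟨x, hx⟩ : K)
  exact Subgroup.mem_subgroupOf.1 (Subgroup.normalCore_le _ this)

/-- A subgroup of finite relative index in `Λ` contains one which is normalized by `Λ`. -/
lemma exists_normalized_subgroup {A : Type*} [Group A] {B Λ : Subgroup A}
    (h : B.relIndex Λ ≠ 0) :
    ∃ M : Subgroup A, M ≤ B ∧ M ≤ Λ ∧ M.relIndex Λ ≠ 0 ∧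
      ∀ g ∈ Λ, ∀ x ∈ M, g * x * g⁻¹ ∈ M := by
  have hfin : (B.subgroupOf Λ).FiniteIndex := ⟨h⟩
  refine ⟨(B.subgroupOf Λ).normalCore.map Λ.subtype, ?_, ?_, ?_, ?_⟩
  · rintro _ ⟨x, hx, rfl⟩
    exact Subgroup.mem_subgroupOf.1 (Subgroup.normalCore_le _ hx)
  · rintro _ ⟨x, -, rfl⟩
    exact x.2
  · rw [Subgroup.relIndex, Subgroup.subgroupOf,
      Subgroup.comap_map_eq_self_of_injective Λ.subtype_injective]
    exact Subgroup.FiniteIndex.index_ne_zero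
  · rintro g hg _ ⟨x, hx, rfl⟩
    exact ⟨⟨g, hg⟩ * x * ⟨g, hg⟩⁻¹, (B.subgroupOf Λ).normalCore_normal.conj_mem x hx ⟨g, hg⟩, rfl⟩

/-- The product of `Γ ≤ Λ` with a subgroup normalized by `Λ`. -/
def mulNormalized {A : Type*} [Group A] (Γ M Λ : Subgroup A) (hΓ : Γ ≤ Λ)
    (hM : ∀ g ∈ Λ, ∀ x ∈ M, g * x * g⁻¹ ∈ M) : Subgroup A where
  carrier := {x | ∃ γ ∈ Γ, ∃ y ∈ M, x = γ * y}
  one_mem' := ⟨1, Γ.one_mem, 1, M.one_mem, by simp⟩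
  mul_mem' := by
    rintro _ _ ⟨γ, hγ, y, hy, rfl⟩ ⟨δ, hδ, z, hz, rfl⟩
    refine ⟨γ * δ, mul_mem hγ hδ, δ⁻¹ * y * δ⁻¹⁻¹ * z,
      mul_mem (hM _ (inv_mem (hΓ hδ)) y hy) hz, by group⟩
  inv_mem' := by
    rintro _ ⟨γ, hγ, y, hy, rfl⟩
    exact ⟨γ⁻¹, inv_mem hγ, γ * y⁻¹ * γ⁻¹, hM _ (hΓ hγ) _ (inv_mem hy), by group⟩

lemma exists_pow_eq_mul {A : Type*} [Group A] {M Λ : Subgroup A}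
    (hM : ∀ g ∈ Λ, ∀ x ∈ M, g * x * g⁻¹ ∈ M) {γ y : A} (hγ : γ ∈ Λ) (hy : y ∈ M) (k : ℕ) :
    ∃ z ∈ M, (γ * y) ^ k = γ ^ k * z := by
  induction k with
  | zero => exact ⟨1, M.one_mem, by simp⟩
  | succ k ih =>
    obtain ⟨z, hz, h⟩ := ih
    refine ⟨γ⁻¹ * z * γ⁻¹⁻¹ * y, mul_mem (hM _ (inv_mem hγ) z hz) hy, ?_⟩
    rw [pow_succ, h, pow_succ]
    group

/-- The congruence subgroup of level `3` is torsion free. -/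
lemma eq_one_of_mem_congruenceSubgroup_three {u : GL (Fin N) ℤ}
    (hu : u ∈ congruenceSubgroup N 3) (hfin : IsOfFinOrder u) : u = 1 := by
  obtain ⟨k, hk, huk⟩ := isOfFinOrder_iff_pow_eq_one.1 hfin
  obtain ⟨w, hw⟩ := mem_congruenceSubgroup_iff.1 hu
  have hukM : (u : Matrix (Fin N) (Fin N) ℤ) ^ k = 1 := by
    rw [← Units.val_pow_eq_pow_val, huk, Units.val_one]
  have hnil : IsNilpotent ((u : Matrix (Fin N) (Fin N) ℤ) - 1) := by
    refine isNilpotent_sub_one_of_roots_norm_eq_one _ w hw fun z hz => ?_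
    rw [← Matrix.mem_spectrum_iff_isRoot_charpoly] at hz
    have h1 := spectrum.pow_mem_pow _ k hz
    have h2 : ((u : Matrix (Fin N) (Fin N) ℤ).map (Int.castRingHom ℂ)) ^ k = 1 := by
      have := congrArg (Int.castRingHom ℂ).mapMatrix hukM
      rwa [map_pow, map_one] at this
    rw [h2] at h1
    rcases subsingleton_or_nontrivial (Matrix (Fin N) (Fin N) ℂ) with hs | hs
    · exact absurd (isUnit_of_subsingleton _) h1
    · rw [spectrum.one_eq, Set.mem_singleton_iff] at h1
      exact Complex.norm_eq_one_of_pow_eq_one h1 hk.ne'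
  have h1 := eq_of_pow_eq_pow_of_isNilpotent_sub_one (isNilpotent_matToRat_sub_one hnil)
    (b := 1) (by simp) hk.ne' (by rw [← map_pow, hukM, map_one, one_pow])
  rw [← map_one (matToRat N)] at h1
  exact Units.ext (matToRat_injective h1)

/-- The group theoretic part of the argument: `ψ` is a homomorphism from a group of integral
matrices which reflects unipotency and is injective on the congruence subgroup of level `3`. -/
theorem exists_torsionFree_of_hom (Z : Subgroup (GL (Fin N) ℤ)) (ψ : Z →* GL (Fin m) ℂ)
    (hunip : ∀ h : Z, (h : GL (Fin N) ℤ) ∈ congruenceSubgroup N 3 →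
      IsNilpotent ((ψ h : Matrix (Fin m) (Fin m) ℂ) - 1) →
      IsNilpotent (((h : GL (Fin N) ℤ) : Matrix (Fin N) (Fin N) ℤ) - 1))
    (hinj : ∀ h : Z, (h : GL (Fin N) ℤ) ∈ congruenceSubgroup N 3 → ψ h = 1 → h = 1)
    (Λ Γ : Subgroup (GL (Fin m) ℂ)) (hcomm : ψ.range.relIndex Λ ≠ 0) (hΓΛ : Γ ≤ Λ)
    (hΓ : TorsionFree Γ) (U : Subgroup (GL (Fin m) ℂ)) (hUle : U ≤ Γ)
    (hUΓ : U.relIndex Γ ≠ 0)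
    (hU : ∀ g ∈ U, IsNilpotent ((g : Matrix (Fin m) (Fin m) ℂ) - 1)) :
    ∃ Λ₀ : Subgroup (GL (Fin m) ℂ),
      Λ₀ ≤ Λ ∧ Λ₀.IsFiniteRelIndex Λ ∧ TorsionFree Λ₀ ∧ Γ ≤ Λ₀ := by
  let B : ℕ → Subgroup (GL (Fin m) ℂ) := fun n => ((congruenceSubgroup N n).subgroupOf Z).map ψ
  have hBindex : ∀ n, 0 < n → (B n).relIndex Λ ≠ 0 := fun n hn => by
    have : NeZero n := ⟨hn.ne'⟩
    refine Subgroup.relIndex_ne_zero_trans ?_ hcomm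
    have hfin : ((congruenceSubgroup N n).subgroupOf Z).FiniteIndex := inferInstance
    rw [MonoidHom.range_eq_map, Subgroup.relIndex_map_map]
    have : ((congruenceSubgroup N n).subgroupOf Z ⊔ ψ.ker).FiniteIndex :=
      Subgroup.finiteIndex_of_le le_sup_left
    rw [top_sup_eq, Subgroup.relIndex_top_right]
    exact Subgroup.FiniteIndex.index_ne_zero
  have hBtf : ∀ x ∈ B 3, IsOfFinOrder x → x = 1 := by
    rintro _ ⟨h, hh, rfl⟩ hfin
    obtain ⟨k, hk, hxk⟩ := isOfFinOrder_iff_pow_eq_one.1 hfin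
    have h1 : h ^ k = 1 := hinj _ (pow_mem (show (h : GL (Fin N) ℤ) ∈ _ from hh) k)
      (by rw [map_pow, hxk])
    have h2 : (h : GL (Fin N) ℤ) = 1 := eq_one_of_mem_congruenceSubgroup_three hh
      (isOfFinOrder_iff_pow_eq_one.2 ⟨k, hk, congrArg Subtype.val h1⟩)
    rw [show h = 1 from Subtype.ext h2, map_one]
  obtain ⟨M₀, hM₀B, hM₀Λ, hM₀index, hM₀norm⟩ := exists_normalized_subgroup (hBindex 3 (by norm_num))
  obtain ⟨D, hD0, hD⟩ := exists_pow_mem_of_isFiniteRelIndex hM₀index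
  have hU'index : (U ⊓ M₀).relIndex Γ ≠ 0 :=
    Subgroup.relIndex_inf_ne_zero hUΓ fun h0 => hM₀index
      (Subgroup.relIndex_eq_zero_of_le_right hΓΛ h0)
  obtain ⟨E, hE0, hE⟩ := exists_pow_mem_of_isFiniteRelIndex hU'index
  -- The level 3 elements lying over `U ⊓ M₀`; `hunip` makes them unipotent.
  let Δ : Subgroup (GL (Fin N) ℤ) :=
    (((U ⊓ M₀).comap ψ) ⊓ (congruenceSubgroup N 3).subgroupOf Z).map Z.subtype
  have hΔ : ∀ u ∈ Δ, IsNilpotent ((u : Matrix (Fin N) (Fin N) ℤ) - 1) := by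
    rintro _ ⟨h, ⟨hh, hh3⟩, rfl⟩
    exact hunip h hh3 (hU _ hh.1)
  have hDE : D * E ≠ 0 := mul_ne_zero hD0 hE0
  obtain ⟨n, hn, hroot⟩ := exists_level_of_powers Δ hΔ hDE
  -- Level `3 * n`: divisibility by 3 gives membership in `Δ`, divisibility by `n` gives roots in
  -- `Δ`.
  obtain ⟨M, hMB, hMΛ, hMindex, hMnorm⟩ := exists_normalized_subgroup
    (Subgroup.relIndex_inf_ne_zero (hBindex (3 * n) (by positivity)) hM₀index)
  refine ⟨mulNormalized Γ M Λ hΓΛ hMnorm, ?_, ⟨fun h0 => hMindex ?_⟩, ?_, ?_⟩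
  · rintro _ ⟨γ, hγ, y, hy, rfl⟩
    exact mul_mem (hΓΛ hγ) (hMΛ hy)
  · have hle : M ≤ mulNormalized Γ M Λ hΓΛ hMnorm :=
      fun y hy => ⟨1, Γ.one_mem, y, hy, (one_mul y).symm⟩
    exact Subgroup.relIndex_eq_zero_of_le_left hle h0
  · rintro _ ⟨γ, hγ, y, hy, rfl⟩ hfin
    have hxD : (γ * y) ^ D = 1 :=
      hBtf _ (hM₀B (hD _ (mul_mem (hΓΛ hγ) (hMΛ hy)))) hfin.pow
    obtain ⟨z, hz, hγz⟩ := exists_pow_eq_mul hMnorm (hΓΛ hγ) hy (D * E)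
    rw [pow_mul, hxD, one_pow] at hγz
    -- Modulo `M` the power of `γ y` is that of `γ`, and it is trivial.
    have hγM : γ ^ (D * E) ∈ M := by
      rw [← inv_eq_of_mul_eq_one_left hγz.symm]
      exact inv_mem hz
    have hγU : γ ^ (D * E) ∈ U ⊓ M₀ := by
      rw [mul_comm, pow_mul]
      exact pow_mem (hE γ hγ) D
    obtain ⟨h, hh, hψh⟩ := (hMB hγM).1
    have hh' : (h : GL (Fin N) ℤ) ∈ congruenceSubgroup N (3 * n) := hh
    have hhΔ : (h : GL (Fin N) ℤ) ∈ Δ :=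
      ⟨h, ⟨show ψ h ∈ U ⊓ M₀ from hψh ▸ hγU,
        congruenceSubgroup_le_of_dvd (Dvd.intro _ rfl) hh'⟩, rfl⟩
    obtain ⟨_, ⟨w, ⟨hw, -⟩, rfl⟩, hwh⟩ :=
      hroot h hhΔ (congruenceSubgroup_le_of_dvd (Dvd.intro_left _ rfl) hh')
    have hwU : ψ w ∈ U ⊓ M₀ := hw
    have hwpow : ψ w ^ (D * E) = γ ^ (D * E) := by
      rw [← hψh, ← map_pow]
      exact congrArg ψ (Subtype.ext hwh)
    -- Both sides are unipotent `D * E`-th roots of `γ ^ (D * E)`.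
    have hcommute : γ * ψ w * γ⁻¹ = ψ w := by
      have hpow : (γ * ψ w * γ⁻¹) ^ (D * E) = ψ w ^ (D * E) := by
        rw [conj_pow, hwpow]
        group
      refine Units.ext (eq_of_pow_eq_pow_of_isNilpotent_sub_one
        (isNilpotent_conj_sub_one (hU _ hwU.1)) (hU _ hwU.1) hDE ?_)
      rw [← Units.val_pow_eq_pow_val, ← Units.val_pow_eq_pow_val, hpow]
    have hcomm' : Commute γ (ψ w) := mul_inv_eq_iff_eq_mul.1 hcommute
    have hone : γ * (ψ w)⁻¹ = 1 := by
      refine hΓ _ (mul_mem hγ (inv_mem (hUle hwU.1)))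
        (isOfFinOrder_iff_pow_eq_one.2 ⟨D * E, Nat.pos_of_ne_zero hDE, ?_⟩)
      rw [hcomm'.inv_right.mul_pow, inv_pow, hwpow, mul_inv_cancel]
    rw [mul_inv_eq_one] at hone
    -- Now `γ = ψ w ∈ M₀`, so `γ * y` lies in the torsion free group `B 3`.
    refine hBtf _ (hM₀B (mul_mem ?_ (hMB hy).2)) hfin
    rw [hone]
    exact hwU.2
  · exact fun γ hγ => ⟨γ, hγ, 1, M.one_mem, (mul_one γ).symm⟩

end ArithLattice

/-! ### Compactness of the kernel and conclusion. -/

namespace ArithLattice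

open Matrix

variable {N : ℕ}

/-- An integral matrix whose powers are bounded has finite order. -/
lemma isOfFinOrder_of_bounded_pow (h : GL (Fin N) ℤ) (B : ℝ)
    (hB : ∀ (k : ℕ) (i j : Fin N), |(((h ^ k : GL (Fin N) ℤ) i j : ℤ) : ℝ)| ≤ B) :
    IsOfFinOrder h := by
  by_contra hfin
  have hinj := injective_pow_iff_not_isOfFinOrder.2 hfin
  have hinj' : Function.Injective fun k : ℕ => fun i j : Fin N => (h ^ k : GL (Fin N) ℤ) i j :=
    fun a b hab => hinj (Units.ext (by ext i j; exact congrFun (congrFun hab i) j))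
  refine Set.infinite_range_of_injective hinj'
    ((Set.finite_Icc (fun _ _ : Fin N => -⌊B⌋) (fun _ _ => ⌊B⌋)).subset ?_)
  rintro _ ⟨k, rfl⟩
  have hle : ∀ i j, |(h ^ k : GL (Fin N) ℤ) i j| ≤ ⌊B⌋ := fun i j => by
    rw [Int.le_floor]
    exact_mod_cast hB k i j
  exact ⟨fun i j => (abs_le.1 (hle i j)).1, fun i j => (abs_le.1 (hle i j)).2⟩

theorem exists_torsionFree_of_isArithmetic {m : ℕ} {G Λ Γ : Subgroup (GL (Fin m) ℂ)}
    (hΛ : IsArithmetic G Λ) (hΓΛ : Γ ≤ Λ) (hΓ : TorsionFree Γ) (hΓu : IsVirtuallyUnipotent Γ) :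
    ∃ Λ₀ : Subgroup (GL (Fin m) ℂ),
      Λ₀ ≤ Λ ∧ Λ₀.IsFiniteRelIndex Λ ∧ TorsionFree Λ₀ ∧ Γ ≤ Λ₀ := by
  obtain ⟨-, N, H, φ, hH, hφ, hker, -, hcomm⟩ := hΛ
  obtain ⟨U, hUΓ, hUfin, hU⟩ := hΓu
  let L := identityComponent (realPoints H)
  let ι : GL (Fin N) ℤ →* GL (Fin N) ℝ := GeneralLinearGroup.map (Int.castRingHom ℝ)
  let ψ : L.comap ι →* GL (Fin m) ℂ := φ.comp (ι.subgroupComap L)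
  have hrange : ψ.range.relIndex Λ ≠ 0 := fun h0 => hcomm.1 <| by
    refine Subgroup.relIndex_eq_zero_of_le_left ?_ h0
    rintro _ ⟨g, ⟨h, hh⟩, rfl⟩
    have hhL : ι h ∈ L := by
      rw [show ι h = (g : GL (Fin N) ℝ) from hh]
      exact g.2
    refine ⟨⟨h, hhL⟩, congrArg φ (Subtype.ext hh)⟩
  refine exists_torsionFree_of_hom (L.comap ι) ψ (fun h h3 hu => ?_) (fun h h3 h1 => ?_) Λ Γ hrange
    hΓΛ hΓ U hUΓ hUfin.relIndex_ne_zero fun g hg => isNilpotent_sub_one_of_isUnipotent hU hg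
  · obtain ⟨w, hw⟩ := mem_congruenceSubgroup_iff.1 h3
    refine isNilpotent_sub_one_of_roots_norm_eq_one _ w hw fun z hz => ?_
    refine norm_eq_one_of_isRoot_charpoly φ hH hφ hker (ι.subgroupComap L h) hu z ?_
    convert hz using 2
    ext i j
    exact Complex.ofReal_intCast (((h : GL (Fin N) ℤ) : Matrix (Fin N) (Fin N) ℤ) i j)
  -- All powers of an integral `h` in the kernel are bounded, so `h` has finite order, and level 3
  -- is torsion free.
  · obtain ⟨B, hB⟩ := exists_bound_of_isCompact_ker φ hker
    refine Subtype.ext (eq_one_of_mem_congruenceSubgroup_three h3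
      (isOfFinOrder_of_bounded_pow _ B fun k i j => ?_))
    have := hB (ι.subgroupComap L (h ^ k)) (by
      rw [map_pow, map_pow, show φ (ι.subgroupComap L h) = 1 from h1, one_pow]) i j
    exact this

end ArithLattice

theorem mainTheorem4 {m : ℕ} (G Λ Γ : Subgroup (Matrix.GeneralLinearGroup (Fin m) ℂ))
    (hG : IsClosed (G : Set (Matrix.GeneralLinearGroup (Fin m) ℂ)))
    (hG₀ : (ArithLattice.identityComponent G).IsFiniteRelIndex G)
    (hΛ : ArithLattice.IsArithmetic G Λ)
    (hΓΛ : Γ ≤ Λ)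
    (hΓ : ArithLattice.TorsionFree Γ)
    (hΓu : ArithLattice.IsVirtuallyUnipotent Γ) :
    ∃ Λ₀ : Subgroup (Matrix.GeneralLinearGroup (Fin m) ℂ),
      Λ₀ ≤ Λ ∧ Λ₀.IsFiniteRelIndex Λ ∧ ArithLattice.TorsionFree Λ₀ ∧ Γ ≤ Λ₀ := by
  exact ArithLattice.exists_torsionFree_of_isArithmetic hΛ hΓΛ hΓ hΓu
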